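/- **Setting.** Let $\mathcal H$ be a separable Hilbert space with orthonormal basis $\{e_\xi\}_{\xi\in\mathcal I}$, $\mathcal I$ countable. Let $\mathcal L,\mathcal M$ be operators on $\mathcal H$ that are diagonal in this basis, $\mathcal L e_\xi=\lambda_\xi e_\xi$ and $\mathcal M e_\xi=\mu_\xi e_\xi$, with real eigenvalues $\lambda_\xi\ge c_L>0$ and $\mu_\xi\ge c_M>0$ for all $\xi\in\mathcal I$ (with maximal domains: $u\in\mathcal H$ is in the domain of $\mathcal L$ iff $\sum_\xi\lambda_\xi^2|(u,e_\xi)|^2<\infty$, and likewise for $\mathcal M$). Let $\mathcal H^1_{\mathcal L}=\{u\in\mathcal H:\mathcal L u\in\mathcal H\}$ and $\mathcal H^1_{\mathcal M}=\{u\in\mathcal H:\mathcal M u\in\mathcal H\}$ be the domains, with the graph norms. Let $0<T<\infty$. For an absolutely continuous $g:[0,T]\to X$ into a Hilbert space $X$, with derivative $g'\in L^1(0,T;X)$, i.e. $g(t)=g(0)+\int_0^t g'(s)\,ds$, the Caputo derivative is $$\mathcal D_t^\alpha g(t)=\frac1{\Gamma(1-\alpha)}\int_0^t (t-s)^{-\alpha}g'(s)\,ds\quad(0<\alpha<1),\qquad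 \mathcal D^1_t g=g'.$$ Let $W^\alpha(0,T;X)$ be the space of such $g$ with $g,\mathcal D_t^\alpha g\in L^2(0,T;X)$. Let $E_{\alpha,\beta}(z)=\sum_{m\ge0}z^m/\Gamma(\alpha m+\beta)$. **Theorem.** Let $0<\alpha<1$, $\varphi\in\mathcal H^1_{\mathcal L}\cap\mathcal H^1_{\mathcal M}$ and $f\in W^1(0,T;\mathcal H)$. Then there is a unique $u\in L^2(0,T;\mathcal H^1_{\mathcal M})\cap W^\alpha(0,T;\mathcal H^1_{\mathcal L})$ such that $$\mathcal D_t^\alpha[u(t)+\mathcal L u(t)]+\mathcal M u(t)=f(t)\ \text{ in }\mathcal H\text{ for a.e. }t\in(0,T),\qquad u(0)=\varphi.$$ For every $t\in[0,T]$ it is given by $$\begin{aligned}u(t)&=\sum_{\xi\in\mathcal I}\varphi_\xi E_{\alpha,1}\Big(-\frac{\mu_\xi}{1+\lambda_\xi}t^\alpha\Big)e_\xi+\sum_{\xi\in\mathcal I}\frac{f_\xi(t)}{\mu_\xi}e_\xi-\sum_{\xi\in\mathcal I}\frac{f_\xi(0)}{\mu_\xi}E_{\alpha,1}\Big(-\frac{\mu_\xi}{1+\lambda_\xi}t^\alpha\Big)e_\xi\\&\quad-\sum_{\xi\in\mathcal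 I}\left[\int_0^t\frac{f'_\xi(t-s)}{\mu_\xi}E_{\alpha,1}\Big(-\frac{\mu_\xi}{1+\lambda_\xi}s^\alpha\Big)ds\right]e_\xi,\end{aligned}$$ where $\varphi_\xi=(\varphi,e_\xi)_{\mathcal H}$, $f_\xi(t)=(f(t),e_\xi)_{\mathcal H}$, $f'_\xi(t)=(f'(t),e_\xi)_{\mathcal H}$, and all four series converge in $\mathcal H$. -/

import Mathlib

open MeasureTheory Set
open scoped InnerProductSpace

/-- The two-parameter Mittag-Leffler function `E_{α,β}(z) = ∑_{m ≥ 0} z ^ m / Γ(α m + β)`. -/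
noncomputable def mittagLeffler (α β z : ℝ) : ℝ :=
  ∑' m : ℕ, z ^ m / Real.Gamma (α * m + β)

section TimeSpaces

variable {X : Type*} [NormedAddCommGroup X] [NormedSpace ℝ X]

/-- The Riemann-Liouville fractional integral, based at time `0`,
`I^β[g](t) = Γ(β)⁻¹ ∫_0^t (t - s)^(β - 1) g(s) ds`, with the usual convention `I^0[g] = g`. -/
noncomputable def fracIntegral (β : ℝ) (g : ℝ → X) (t : ℝ) : X :=
  if β = 0 then g t
  else (Real.Gamma β)⁻¹ • ∫ s in (0 : ℝ)..t, (t - s) ^ (β - 1) • g s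

/-- `g ∈ L²(0,T;X)`. -/
def MemL2 (T : ℝ) (g : ℝ → X) : Prop :=
  MemLp g 2 (volume.restrict (Icc 0 T))

/-- `g` is differentiable on `[0,T]` in the sense of Sobolev spaces, with derivative `g'`: `g'` is
Bochner integrable on `(0,T)` and `g` is its indefinite integral.  (So `g` is the absolutely
continuous representative of its class, and `g'` is its weak, and almost everywhere its pointwise,
derivative.) -/
def HasTimeDeriv (T : ℝ) (g g' : ℝ → X) : Prop :=
  IntervalIntegrable g' volume 0 T ∧ ∀ t ∈ Icc 0 T, g t = g 0 + ∫ s in (0 : ℝ)..t, g' s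

/-- `v` is the Caputo derivative of order `α ∈ (0,1]` of `g` on `(0,T)`:
`v = I^(1-α)[g']` almost everywhere (`v = g'` for `α = 1`). -/
def HasCaputoDeriv (α T : ℝ) (g v : ℝ → X) : Prop :=
  ∃ g' : ℝ → X, HasTimeDeriv T g g' ∧
    ∀ᵐ t ∂(volume.restrict (Icc 0 T)), v t = fracIntegral (1 - α) g' t

/-- `g ∈ W^α(0,T;X)`: `g` and its Caputo derivative of order `α` are square integrable. -/
def MemW (α T : ℝ) (g : ℝ → X) : Prop :=
  MemL2 T g ∧ ∃ v : ℝ → X, HasCaputoDeriv α T g v ∧ MemL2 T v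

end TimeSpaces

section Operators

variable {𝕜 H I : Type*} [RCLike 𝕜] [NormedAddCommGroup H] [InnerProductSpace 𝕜 H]

/-- The (possibly unbounded) operator `A` is diagonal in the orthonormal basis `e`, with
eigenvalues `a ξ`: `A (∑ u_ξ e_ξ) = ∑ a_ξ u_ξ e_ξ`, where `u` belongs to the domain of `A` as soon
as the sequence `a_ξ u_ξ` is the coefficient sequence of an element of `H`. -/
def IsDiagonalIn (A : H →ₗ.[𝕜] H) (e : HilbertBasis I 𝕜 H) (a : I → ℝ) : Prop :=
  ∀ u v : H, (u, v) ∈ A.graph ↔ ∀ ξ, ⟪e ξ, v⟫_𝕜 = (a ξ : 𝕜) * ⟪e ξ, u⟫_𝕜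

/-- `L` and `M` are diagonalised by the same orthonormal basis, with real eigenvalues that are
bounded below by positive constants. -/
structure JointlyDiagonal (L M : H →ₗ.[𝕜] H) (e : HilbertBasis I 𝕜 H) (lam mu : I → ℝ) :
    Prop where
  diag_left : IsDiagonalIn L e lam
  diag_right : IsDiagonalIn M e mu
  left_pos : ∃ c : ℝ, 0 < c ∧ ∀ ξ, c ≤ lam ξ
  right_pos : ∃ c : ℝ, 0 < c ∧ ∀ ξ, c ≤ mu ξ

/-- `u ∈ L²(0,T;H¹_A)`, where `H¹_A = {u ∈ H : A u ∈ H}` is the domain of `A` with the graph norm: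
`u(t)` lies in the domain for almost every `t`, and `u`, `A u` are square integrable. -/
def MemL2Dom (A : H →ₗ.[𝕜] H) (T : ℝ) (u : ℝ → H) : Prop :=
  MemL2 T u ∧ ∃ Au : ℝ → H,
    (∀ᵐ t ∂(volume.restrict (Icc 0 T)), (u t, Au t) ∈ A.graph) ∧ MemL2 T Au

variable [NormedSpace ℝ H]

/-- `u ∈ W^α(0,T;H¹_A)`, where `H¹_A` is the domain of `A` with the graph norm: `u` takes values in
the domain, and `t ↦ (u(t), A u(t))`, a map to the graph of `A`, is of class `W^α`. -/
def MemWDom (A : H →ₗ.[𝕜] H) (α T : ℝ) (u : ℝ → H) : Prop :=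
  MemW α T u ∧ ∃ Au : ℝ → H, (∀ t ∈ Icc 0 T, (u t, Au t) ∈ A.graph) ∧ MemW α T Au

/-- `u` is a generalised solution, in `L²(0,T;H¹_M) ∩ W^α(0,T;H¹_L)`, of the Cauchy problem
`D_t^α [u + L u] + M u = f` on `(0,T)`, `u(0) = φ`; the equation holds in `H` for almost every
time. -/
structure IsGeneralisedSolution (L M : H →ₗ.[𝕜] H) (α T : ℝ) (φ : H) (f u : ℝ → H) : Prop where
  memL2 : MemL2Dom M T u
  memW : MemWDom L α T u
  initial : u 0 = φ
  equation : ∃ Lu Mu v : ℝ → H,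
    (∀ t ∈ Icc 0 T, (u t, Lu t) ∈ L.graph) ∧
    (∀ᵐ t ∂(volume.restrict (Icc 0 T)), (u t, Mu t) ∈ M.graph) ∧
    HasCaputoDeriv α T (fun t => u t + Lu t) v ∧
    ∀ᵐ t ∂(volume.restrict (Icc 0 T)), v t + Mu t = f t

end Operators

/-! In the coordinate `ξ` the problem is scalar: with κ = μ_ξ/(1+λ_ξ), the function y = (1+λ_ξ)u_ξ
solves D^α y = f_ξ − κy. The kernel p(t) = t^(α−1) E_{α,α}(−κt^α) satisfies I^(1−α)p =
E_{α,1}(−κt^α) and κ I^1 p = 1 − E_{α,1}(−κt^α). Hence q = cp + p∗f_ξ', with c = f_ξ(0) − μ_ξφ_ξ,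
satisfies I^(1−α)q + κ I^1 q = c + f_ξ − f_ξ(0), which is the equation for y' = q.

Since κ may be unbounded in `ξ`, assembling the coordinates needs 0 ≤ p ≤ t^(α−1)/Γ(α), uniformly in
κ (`mlKernel_nonneg`, `mlKernel_le`); this rests on the positivity of E_{α,α} on the nonpositive
half-line (`mittagLeffler_self_pos`). Then q is Bochner integrable in `H`
(`HilbertBasis.exists_mlKernel_response`), and I^(1−α)q is bounded because I^(1−α)I^α = I^1. The
solution is u = (1+L)⁻¹(φ + Lφ + ∫q), and Mu = f − I^(1−α)q inherits its regularity from the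
right-hand side. Every exchange of convolutions is Fubini on a triangle, under the hypothesis
`BoundedConvolution`.

For uniqueness, the difference of two solutions satisfies d = −κ I^α d in each coordinate; iterating
bounds |d| by terms of a convergent Mittag-Leffler series
(`HasTimeDeriv.eq_zero_of_fracIntegral_eq`). -/

/-! ### The Mittag-Leffler series. -/

theorem rpow_mul_exp_le_Gamma {x R : ℝ} (hx : 1 ≤ x) (hR : 0 < R) :
    R ^ (x - 1) * Real.exp (-(R + 1)) ≤ Real.Gamma x := by
  have hx0 : 0 < x := by linarith
  rw [Real.Gamma_eq_integral hx0]
  have hint := Real.GammaIntegral_convergent hx0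
  -- Only the window `(R, R + 1]` of Euler's integral is kept. As `R` is free, Γ outgrows every
  -- exponential.
  calc R ^ (x - 1) * Real.exp (-(R + 1))
      = ∫ _ in Ioc R (R + 1), R ^ (x - 1) * Real.exp (-(R + 1)) := by simp
    _ ≤ ∫ t in Ioc R (R + 1), Real.exp (-t) * t ^ (x - 1) := by
        refine setIntegral_mono_on continuous_const.integrableOn_Ioc (hint.mono_set fun t ht => hR.trans ht.1)
          measurableSet_Ioc fun t ht => ?_
        rw [mul_comm]
        have := ht.1
        have := ht.2
        gcongr
    _ ≤ ∫ t in Ioi 0, Real.exp (-t) * t ^ (x - 1) := by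
        refine setIntegral_mono_set hint ?_ (LE.le.eventuallyLE fun t ht => hR.trans ht.1)
        filter_upwards [ae_restrict_mem measurableSet_Ioi] with t ht
        have : 0 < t := ht
        positivity

theorem summable_mittagLeffler {α β : ℝ} (hα : 0 < α) (hβ : 0 < β) (z : ℝ) :
    Summable fun m : ℕ => z ^ m / Real.Gamma (α * m + β) := by
  -- With this `R` the Gamma bound makes the terms decay like `(1 / 2) ^ m`; `N > 1 / α` below puts
  -- the argument of Γ above 1.
  obtain ⟨R, hR, hRz⟩ : ∃ R : ℝ, 0 < R ∧ 2 * |z| ≤ R ^ α := by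
    refine ⟨(2 * |z| + 1) ^ α⁻¹, by positivity, ?_⟩
    rw [← Real.rpow_mul (by positivity), inv_mul_cancel₀ hα.ne', Real.rpow_one]
    linarith
  obtain ⟨N, hN⟩ := exists_nat_gt (1 / α)
  refine Summable.of_norm_bounded_eventually
    (g := fun m : ℕ => (R ^ (β - 1) * Real.exp (-(R + 1)))⁻¹ * (1 / 2 : ℝ) ^ m)
    (summable_geometric_two.mul_left _) ?_
  rw [Nat.cofinite_eq_atTop]
  filter_upwards [Filter.eventually_ge_atTop N] with m hm
  have h1 : 1 ≤ α * m + β := by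
    have : 1 / α < m := hN.trans_le (by exact_mod_cast hm)
    rw [div_lt_iff₀ hα] at this
    nlinarith
  have h2 := rpow_mul_exp_le_Gamma h1 hR
  have h3 : R ^ (α * m + β - 1) = R ^ (β - 1) * (R ^ α) ^ m := by
    rw [← Real.rpow_natCast (R ^ α), ← Real.rpow_mul hR.le, ← Real.rpow_add hR]
    ring_nf
  rw [norm_div, norm_pow, Real.norm_eq_abs, Real.norm_eq_abs,
    abs_of_pos (Real.Gamma_pos_of_pos (by linarith)), div_le_iff₀ (Real.Gamma_pos_of_pos (by linarith))]
  have hpos : 0 < R ^ (β - 1) * Real.exp (-(R + 1)) := by positivity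
  have h4 : |z| ^ m ≤ (1 / 2 : ℝ) ^ m * (R ^ α) ^ m := by
    rw [← mul_pow]
    gcongr
    linarith
  calc |z| ^ m ≤ (1 / 2 : ℝ) ^ m * (R ^ α) ^ m := h4
    _ = (R ^ (β - 1) * Real.exp (-(R + 1)))⁻¹ * (1 / 2) ^ m *
        (R ^ (α * m + β - 1) * Real.exp (-(R + 1))) := by
        rw [h3]
        field_simp
    _ ≤ _ := by gcongr

theorem continuous_mittagLeffler {α β : ℝ} (hα : 0 < α) (hβ : 0 < β) :
    Continuous (mittagLeffler α β) := by
  rw [continuous_iff_continuousAt]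
  intro z
  have : ContinuousOn (mittagLeffler α β) (Metric.ball 0 (|z| + 1)) := by
    refine continuousOn_tsum (u := fun m : ℕ => (|z| + 1) ^ m / Real.Gamma (α * m + β))
      (fun m => by fun_prop) (summable_mittagLeffler hα hβ _) fun m w hw => ?_
    have hΓ : 0 < Real.Gamma (α * m + β) := Real.Gamma_pos_of_pos (by positivity)
    rw [norm_div, norm_pow, Real.norm_of_nonneg hΓ.le]
    rw [mem_ball_zero_iff] at hw
    gcongr
  exact this.continuousAt (Metric.isOpen_ball.mem_nhds (by simp))

theorem mittagLeffler_zero (α β : ℝ) : mittagLeffler α β 0 = (Real.Gamma β)⁻¹ := by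
  rw [mittagLeffler, tsum_eq_single 0 fun m hm => by simp [hm]]
  simp

theorem mittagLeffler_eq_add_mul {α β : ℝ} (hα : 0 < α) (hβ : 0 < β) (z : ℝ) :
    mittagLeffler α β z = (Real.Gamma β)⁻¹ + z * mittagLeffler α (α + β) z := by
  rw [mittagLeffler, (summable_mittagLeffler hα hβ z).tsum_eq_zero_add, mittagLeffler, ← tsum_mul_left]
  congr 1
  · simp
  · refine tsum_congr fun m => ?_
    push_cast
    rw [pow_succ']
    ring_nf

/-! ### Beta integrals and fractional integrals of Mittag-Leffler functions. -/

theorem integral_sub_rpow_mul_rpow {β γ t : ℝ} (hβ : 0 < β) (hγ : 0 < γ) (ht : 0 < t) :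
    ∫ s in (0 : ℝ)..t, (t - s) ^ (β - 1) * s ^ (γ - 1) =
      Real.Gamma β * Real.Gamma γ / Real.Gamma (β + γ) * t ^ (β + γ - 1) := by
  have h := Complex.betaIntegral_scaled (γ : ℂ) β ht
  rw [Complex.betaIntegral_eq_Gamma_mul_div _ _ (by simpa) (by simpa)] at h
  have h' : ∫ s in (0 : ℝ)..t, (s : ℂ) ^ ((γ : ℂ) - 1) * ((t : ℂ) - s) ^ ((β : ℂ) - 1) =
      ((∫ s in (0 : ℝ)..t, (t - s) ^ (β - 1) * s ^ (γ - 1) : ℝ) : ℂ) := by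
    rw [← intervalIntegral.integral_ofReal]
    refine intervalIntegral.integral_congr fun s hs => ?_
    rw [uIcc_of_le ht.le] at hs
    push_cast
    rw [Complex.ofReal_cpow (by linarith [hs.2]), Complex.ofReal_cpow hs.1]
    push_cast
    ring
  rw [h'] at h
  have : ((t : ℂ) ^ ((γ : ℂ) + β - 1)) = ((t ^ (γ + β - 1) : ℝ) : ℂ) := by
    rw [Complex.ofReal_cpow ht.le]
    push_cast
    ring_nf
  rw [this, ← Complex.ofReal_add, Complex.Gamma_ofReal, Complex.Gamma_ofReal, Complex.Gamma_ofReal] at h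
  rw [add_comm β γ]
  have h3 : ((∫ s in (0 : ℝ)..t, (t - s) ^ (β - 1) * s ^ (γ - 1) : ℝ) : ℂ) =
      ((t ^ (γ + β - 1) * (Real.Gamma γ * Real.Gamma β / Real.Gamma (γ + β)) : ℝ) : ℂ) := by
    rw [h]; push_cast; ring
  rw [Complex.ofReal_inj.1 h3]
  ring

theorem intervalIntegrable_sub_rpow_mul_rpow {β γ t : ℝ} (hβ : 0 < β) (hγ : 0 < γ) (ht : 0 < t) :
    IntervalIntegrable (fun s => (t - s) ^ (β - 1) * s ^ (γ - 1)) volume 0 t := by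
  -- A non-integrable function has integral 0 by convention, so the nonzero Beta value already
  -- proves integrability.
  apply intervalIntegral.intervalIntegrable_of_integral_ne_zero
  rw [integral_sub_rpow_mul_rpow hβ hγ ht]
  have := Real.Gamma_pos_of_pos hβ
  have := Real.Gamma_pos_of_pos hγ
  have := Real.Gamma_pos_of_pos (add_pos hβ hγ)
  positivity

/-- Termwise, the Beta integral trades Γ(αm+γ) for Γ(αm+β+γ). The integrals of the norms form the
same series with |κ| in place of −κ, which justifies exchanging sum and integral. -/
theorem integral_sub_rpow_mul_mittagLeffler {α β γ t : ℝ} (κ : ℝ) (hα : 0 < α) (hβ : 0 < β) (hγ : 0 < γ)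
    (ht : 0 < t) :
    ∫ s in (0 : ℝ)..t, (t - s) ^ (β - 1) * (s ^ (γ - 1) * mittagLeffler α γ (-κ * s ^ α)) =
      Real.Gamma β * (t ^ (β + γ - 1) * mittagLeffler α (β + γ) (-κ * t ^ α)) := by
  set F : ℕ → ℝ → ℝ := fun m s =>
    (-κ) ^ m / Real.Gamma (α * m + γ) * ((t - s) ^ (β - 1) * s ^ (α * m + γ - 1)) with hF
  have hγm : ∀ m : ℕ, 0 < α * m + γ := fun m => by positivity
  have hI : ∀ m, Integrable (F m) (volume.restrict (Ioc 0 t)) := fun m => by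
    have := (intervalIntegrable_sub_rpow_mul_rpow hβ (hγm m) ht).const_mul
      ((-κ) ^ m / Real.Gamma (α * m + γ))
    rwa [intervalIntegrable_iff_integrableOn_Ioc_of_le ht.le] at this
  have hnorm : ∀ m, ∀ s ∈ Ioc 0 t, ‖F m s‖ =
      |κ| ^ m / Real.Gamma (α * m + γ) * ((t - s) ^ (β - 1) * s ^ (α * m + γ - 1)) := fun m s hs => by
    have h1 : 0 ≤ t - s := by linarith [hs.2]
    have h2 : 0 ≤ s := hs.1.le
    have hΓ := Real.Gamma_pos_of_pos (hγm m)
    rw [hF, norm_mul, norm_div, norm_pow, norm_neg, Real.norm_eq_abs, Real.norm_of_nonneg hΓ.le,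
      Real.norm_of_nonneg (by positivity)]
  have hcalc : ∀ (c : ℝ) (m : ℕ), ∫ s in Ioc 0 t, c ^ m / Real.Gamma (α * m + γ) *
      ((t - s) ^ (β - 1) * s ^ (α * m + γ - 1)) =
      Real.Gamma β * t ^ (β + γ - 1) * ((c * t ^ α) ^ m / Real.Gamma (α * m + (β + γ))) := fun c m => by
    rw [integral_const_mul, ← intervalIntegral.integral_of_le ht.le,
      integral_sub_rpow_mul_rpow hβ (hγm m) ht, mul_pow, ← Real.rpow_natCast (t ^ α) m,
      ← Real.rpow_mul ht.le, show β + (α * m + γ) - 1 = (β + γ - 1) + α * m by ring,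
      Real.rpow_add ht, show β + (α * m + γ) = α * m + (β + γ) by ring]
    have hΓ := (Real.Gamma_pos_of_pos (hγm m)).ne'
    field_simp
  have hS : Summable fun m => ∫ s in Ioc 0 t, ‖F m s‖ := by
    have : (fun m => ∫ s in Ioc 0 t, ‖F m s‖) = fun m : ℕ =>
        Real.Gamma β * t ^ (β + γ - 1) * ((|κ| * t ^ α) ^ m / Real.Gamma (α * m + (β + γ))) := by
      funext m
      rw [← hcalc, setIntegral_congr_fun measurableSet_Ioc (hnorm m)]
    rw [this]
    exact (summable_mittagLeffler hα (by positivity) _).mul_left _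
  have h := hasSum_integral_of_summable_integral_norm hI hS
  have h2 : ∀ m, ∫ s in Ioc 0 t, F m s =
      Real.Gamma β * t ^ (β + γ - 1) * ((-κ * t ^ α) ^ m / Real.Gamma (α * m + (β + γ))) :=
    fun m => hcalc _ m
  simp_rw [h2] at h
  rw [intervalIntegral.integral_of_le ht.le, ← mul_assoc, mittagLeffler, ← tsum_mul_left, h.tsum_eq]
  refine setIntegral_congr_fun measurableSet_Ioc fun s hs => ?_
  simp only [hF, mittagLeffler]
  rw [← mul_assoc, ← tsum_mul_left]
  refine tsum_congr fun m => ?_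
  rw [mul_pow, ← Real.rpow_natCast (s ^ α) m, ← Real.rpow_mul hs.1.le,
    show α * m + γ - 1 = (γ - 1) + α * m by ring, Real.rpow_add hs.1]
  ring

theorem intervalIntegrable_mul_mittagLeffler {α β γ t : ℝ} (κ : ℝ) (hα : 0 < α) (hβ : 0 < β)
    (hγ : 0 < γ) (ht : 0 < t) :
    IntervalIntegrable (fun s => (t - s) ^ (β - 1) * (s ^ (γ - 1) * mittagLeffler α γ (-κ * s ^ α)))
      volume 0 t := by
  simp_rw [← mul_assoc]
  refine (intervalIntegrable_sub_rpow_mul_rpow hβ hγ ht).mul_continuousOn ?_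
  exact ((continuous_mittagLeffler hα hγ).comp
    ((Real.continuous_rpow_const hα.le).const_mul _)).continuousOn

/-! ### Positivity and bounds on the negative half-line. -/

/-- First-zero argument: the resolvent of the log-convex kernel `t ^ (α - 1)` stays positive. -/
theorem mittagLeffler_self_pos {α x : ℝ} (hα₀ : 0 < α) (hα₁ : α < 1) (hx : 0 ≤ x) :
    0 < mittagLeffler α α (-x) := by
  have hΓ := Real.Gamma_pos_of_pos hα₀
  set e : ℝ → ℝ := fun t => mittagLeffler α α (-1 * t ^ α) with he
  have hec : Continuous e := (continuous_mittagLeffler hα₀ hα₀).comp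
    ((Real.continuous_rpow_const hα₀.le).const_mul _)
  set p : ℝ → ℝ := fun t => t ^ (α - 1) * e t with hp
  -- The resolvent equation Γ(α)p = k − k∗p for k(t) = t^(α−1).
  have hres : ∀ t, 0 < t → Real.Gamma α * p t =
      t ^ (α - 1) - ∫ s in (0 : ℝ)..t, (t - s) ^ (α - 1) * p s := by
    intro t ht
    rw [integral_sub_rpow_mul_mittagLeffler 1 hα₀ hα₀ hα₀ ht]
    simp only [hp, he]
    rw [mittagLeffler_eq_add_mul hα₀ hα₀ (-1 * t ^ α),
      show α + α - 1 = (α - 1) + α by ring, Real.rpow_add ht]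
    field_simp
    ring
  have hint : ∀ t, 0 < t → IntervalIntegrable (fun s => (t - s) ^ (α - 1) * p s) volume 0 t :=
    fun t ht => intervalIntegrable_mul_mittagLeffler 1 hα₀ hα₀ hα₀ ht
  suffices h : ∀ t, 0 ≤ t → 0 < e t by
    have := h (x ^ α⁻¹) (by positivity)
    simpa [he, ← Real.rpow_mul hx, inv_mul_cancel₀ hα₀.ne'] using this
  by_contra! hcon
  set Z : Set ℝ := {t | 0 ≤ t ∧ e t ≤ 0} with hZ
  have hZc : IsClosed Z := isClosed_Ici.inter (isClosed_le hec continuous_const)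
  have hZb : BddBelow Z := ⟨0, fun t ht => ht.1⟩
  have hZm := hZc.csInf_mem hcon hZb
  set b := sInf Z with hb
  have hlt : ∀ t, 0 ≤ t → t < b → 0 < e t := fun t ht htb => by
    by_contra! h
    exact absurd (csInf_le hZb ⟨ht, h⟩) (not_le.2 htb)
  have hb0 : 0 < b := by
    rcases hZm.1.lt_or_eq with h | h
    · exact h
    · have h2 := hZm.2
      rw [← h] at h2
      simp only [he, Real.zero_rpow hα₀.ne', mul_zero, mittagLeffler_zero] at h2
      exact absurd (inv_pos.2 hΓ) (not_lt.2 h2)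
  -- `δ ≤ b / 2` keeps k(b)/k(t) at least 1/2 on the last stretch before the zero `b`; the bound on
  -- `δ ^ α` makes the recent memory too small to compensate.
  obtain ⟨δ, hδ0, hδb, hδ⟩ : ∃ δ : ℝ, 0 < δ ∧ δ ≤ b / 2 ∧ δ ^ α < α * Real.Gamma α / 2 := by
    have h1 : Filter.Tendsto (fun d : ℝ => d ^ α) (nhdsWithin 0 (Ioi 0)) (nhds 0) := by
      have := (Real.continuous_rpow_const (q := α) hα₀.le).tendsto 0
      rw [Real.zero_rpow hα₀.ne'] at this
      exact this.mono_left nhdsWithin_le_nhds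
    have h2 : ∀ᶠ d in nhdsWithin (0 : ℝ) (Ioi 0), d ^ α < α * Real.Gamma α / 2 :=
      h1.eventually_lt_const (by positivity)
    have h3 : ∀ᶠ d in nhdsWithin (0 : ℝ) (Ioi 0), d < b / 2 :=
      nhdsWithin_le_nhds (Iio_mem_nhds (by positivity))
    obtain ⟨d, ⟨h4, h5⟩, h6⟩ := ((h2.and h3).and self_mem_nhdsWithin).exists
    exact ⟨d, h6, h5.le, h4⟩
  have hpc : ContinuousOn p (Icc (b - δ) b) := by
    refine ContinuousOn.mul (fun t ht => ?_) hec.continuousOn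
    exact (Real.continuousAt_rpow_const _ _ (Or.inl (by linarith [ht.1] : 0 < t).ne')).continuousWithinAt
  -- The resolvent equation at `b` is compared with that at a maximum point of `p` on the last
  -- stretch, so that `p t` controls all values of `p` between `t` and `b`.
  obtain ⟨t, ht, hmax⟩ := isCompact_Icc.exists_isMaxOn (nonempty_Icc.2 (by linarith)) hpc
  have hppos : ∀ s, 0 < s → s < b → 0 < p s := fun s hs hsb =>
    mul_pos (Real.rpow_pos_of_pos hs _) (hlt s hs.le hsb)
  have hpb : p b ≤ 0 := mul_nonpos_of_nonneg_of_nonpos (by positivity) hZm.2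
  have ht0 : 0 < t := by linarith [ht.1]
  have hptpos : 0 < p t :=
    (hppos (b - δ) (by linarith) (by linarith)).trans_le (hmax (left_mem_Icc.2 (by linarith)))
  have htb : t < b := lt_of_le_of_ne ht.2 fun h => by rw [h] at hptpos; linarith
  have hsub1 : IntervalIntegrable (fun s => (b - s) ^ (α - 1) * p s) volume 0 t :=
    (hint b hb0).mono_set (by rw [uIcc_of_le ht0.le, uIcc_of_le hb0.le]; exact Icc_subset_Icc_right ht.2)
  have hsub2 : IntervalIntegrable (fun s => (b - s) ^ (α - 1) * p s) volume t b :=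
    (hint b hb0).mono_set (by rw [uIcc_of_le ht.2, uIcc_of_le hb0.le]; exact Icc_subset_Icc_left ht0.le)
  have hsplit := intervalIntegral.integral_add_adjacent_intervals hsub1 hsub2
  -- by log-convexity, the past weighs at most `k(b) / k(t)` times what it did at time `t`
  have hpast : ∫ s in (0 : ℝ)..t, (b - s) ^ (α - 1) * p s ≤
      b ^ (α - 1) / t ^ (α - 1) * ∫ s in (0 : ℝ)..t, (t - s) ^ (α - 1) * p s := by
    rw [← intervalIntegral.integral_const_mul]
    refine intervalIntegral.integral_mono_on_of_le_Ioo ht0.le hsub1 ((hint t ht0).const_mul _)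
      fun s hs => ?_
    rw [← mul_assoc (b ^ (α - 1) / t ^ (α - 1))]
    refine mul_le_mul_of_nonneg_right ?_ (hppos s hs.1 (hs.2.trans htb)).le
    have h1 : 0 < t - s := by linarith [hs.2]
    have h2 : 0 < b - s := by linarith
    rw [div_mul_eq_mul_div, le_div_iff₀ (by positivity), ← Real.mul_rpow h2.le ht0.le,
      ← Real.mul_rpow hb0.le h1.le]
    refine Real.rpow_le_rpow_of_nonpos (by positivity) ?_ (by linarith)
    nlinarith [hs.1]
  have hrec : ∫ s in t..b, (b - s) ^ (α - 1) * p s ≤ p t * ((b - t) ^ α / α) := by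
    have hk : IntervalIntegrable (fun s => (b - s) ^ (α - 1)) volume t b := by
      have := (intervalIntegral.intervalIntegrable_rpow' (a := b - t) (b := 0) (r := α - 1)
        (by linarith)).comp_sub_left b
      simpa using this
    calc ∫ s in t..b, (b - s) ^ (α - 1) * p s ≤ ∫ s in t..b, p t * (b - s) ^ (α - 1) := by
          refine intervalIntegral.integral_mono_on ht.2 hsub2 (hk.const_mul _) fun s hs => ?_
          rw [mul_comm]
          have h2 : 0 ≤ b - s := by linarith [hs.2]
          exact mul_le_mul_of_nonneg_right (hmax ⟨ht.1.trans hs.1, hs.2⟩) (by positivity)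
      _ = p t * ((b - t) ^ α / α) := by
          rw [intervalIntegral.integral_const_mul, intervalIntegral.integral_comp_sub_left
            (fun s => s ^ (α - 1)), integral_rpow (Or.inl (by linarith))]
          simp [Real.zero_rpow hα₀.ne']
  have hrb := hres b hb0
  have hrt := hres t ht0
  have hkt : 0 < t ^ (α - 1) := by positivity
  have hkb : 0 < b ^ (α - 1) := by positivity
  have h1 : b ^ (α - 1) / t ^ (α - 1) * (Real.Gamma α * p t) ≤ p t * ((b - t) ^ α / α) := by
    have : b ^ (α - 1) / t ^ (α - 1) * (Real.Gamma α * p t) = b ^ (α - 1) -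
        b ^ (α - 1) / t ^ (α - 1) * ∫ s in (0 : ℝ)..t, (t - s) ^ (α - 1) * p s := by
      rw [hrt, mul_sub, div_mul_cancel₀ _ hkt.ne']
    have := mul_nonpos_of_nonneg_of_nonpos hΓ.le hpb
    linarith
  have h2 : (1 : ℝ) / 2 ≤ b ^ (α - 1) / t ^ (α - 1) := by
    rw [← Real.div_rpow hb0.le ht0.le]
    have h3 : b / t ≤ 2 := by
      rw [div_le_iff₀ ht0]; linarith [ht.1]
    calc (1 : ℝ) / 2 = 2 ^ (-1 : ℝ) := by rw [Real.rpow_neg_one]; norm_num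
      _ ≤ 2 ^ (α - 1) := Real.rpow_le_rpow_of_exponent_le (by norm_num) (by linarith)
      _ ≤ (b / t) ^ (α - 1) := Real.rpow_le_rpow_of_nonpos (by positivity) h3 (by linarith)
  have h3 : (b - t) ^ α ≤ δ ^ α := Real.rpow_le_rpow (by linarith) (by linarith [ht.1]) hα₀.le
  have h4 : 1 / 2 * (Real.Gamma α * p t) ≤ p t * ((b - t) ^ α / α) :=
    (mul_le_mul_of_nonneg_right h2 (by positivity)).trans h1
  have h5 : 1 / 2 * Real.Gamma α ≤ (b - t) ^ α / α := by
    refine le_of_mul_le_mul_right ?_ hptpos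
    linarith
  rw [le_div_iff₀ hα₀] at h5
  linarith

/-- For β > α the value is, up to Γ(β−α), the integral at time 1 of a positive kernel against the
function of parameters (α, α). -/
theorem mittagLeffler_neg_nonneg {α β x : ℝ} (hα₀ : 0 < α) (hα₁ : α < 1) (hβ : α ≤ β) (hx : 0 ≤ x) :
    0 ≤ mittagLeffler α β (-x) := by
  rcases hβ.eq_or_lt with rfl | hβ
  · exact (mittagLeffler_self_pos hα₀ hα₁ hx).le
  have h := integral_sub_rpow_mul_mittagLeffler x hα₀ (sub_pos.2 hβ) hα₀ one_pos
  simp only [sub_add_cancel, Real.one_rpow, mul_one, one_mul] at h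
  have hΓ := Real.Gamma_pos_of_pos (sub_pos.2 hβ)
  refine nonneg_of_mul_nonneg_right (b := mittagLeffler α β (-x)) ?_ hΓ
  rw [← h]
  refine intervalIntegral.integral_nonneg zero_le_one fun s hs => ?_
  have h1 : 0 ≤ 1 - s := by linarith [hs.2]
  have h2 := hs.1
  have h3 : 0 < mittagLeffler α α (-(x * s ^ α)) :=
    mittagLeffler_self_pos hα₀ hα₁ (by positivity)
  rw [← neg_mul] at h3
  positivity

theorem mittagLeffler_neg_le {α β x : ℝ} (hα₀ : 0 < α) (hα₁ : α < 1) (hβ : 0 < β) (hx : 0 ≤ x) :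
    mittagLeffler α β (-x) ≤ (Real.Gamma β)⁻¹ := by
  rw [mittagLeffler_eq_add_mul hα₀ hβ]
  nlinarith [mul_nonneg hx (mittagLeffler_neg_nonneg hα₀ hα₁ (by linarith : α ≤ α + β) hx)]

/-! ### The two families of kernels. -/

/-- The kernel `t ^ (β - 1) / Γ(β)` of the Riemann-Liouville integral of order `β`. -/
noncomputable def rlKernel (β t : ℝ) : ℝ := t ^ (β - 1) / Real.Gamma β

/-- The kernel `t ^ (α - 1) E_{α,α}(-κ t ^ α)`. -/
noncomputable def mlKernel (α κ t : ℝ) : ℝ := t ^ (α - 1) * mittagLeffler α α (-κ * t ^ α)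

/-- The convolution `t ↦ ∫_0^t a(t - s) g(s) ds`. -/
noncomputable def volterra {E : Type*} [NormedAddCommGroup E] [NormedSpace ℝ E] (a : ℝ → ℝ)
    (g : ℝ → E) (t : ℝ) : E := ∫ s in (0 : ℝ)..t, a (t - s) • g s

theorem fracIntegral_eq_volterra {E : Type*} [NormedAddCommGroup E] [NormedSpace ℝ E] {β : ℝ}
    (hβ : β ≠ 0) (g : ℝ → E) (t : ℝ) : fracIntegral β g t = volterra (rlKernel β) g t := by
  rw [fracIntegral, if_neg hβ, volterra, ← intervalIntegral.integral_smul]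
  refine intervalIntegral.integral_congr fun s _ => ?_
  simp only [rlKernel, smul_smul, div_eq_inv_mul]

theorem measurable_rlKernel (β : ℝ) : Measurable (rlKernel β) := by
  unfold rlKernel
  fun_prop

theorem rlKernel_nonneg {β t : ℝ} (hβ : 0 < β) (ht : 0 ≤ t) : 0 ≤ rlKernel β t :=
  div_nonneg (Real.rpow_nonneg ht _) (Real.Gamma_pos_of_pos hβ).le

theorem measurable_mlKernel {α : ℝ} (hα : 0 < α) (κ : ℝ) : Measurable (mlKernel α κ) := by
  have := (continuous_mittagLeffler hα hα).measurable
  unfold mlKernel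
  fun_prop

theorem mlKernel_nonneg {α κ t : ℝ} (hα₀ : 0 < α) (hα₁ : α < 1) (hκ : 0 ≤ κ) (ht : 0 ≤ t) :
    0 ≤ mlKernel α κ t := by
  have := mittagLeffler_neg_nonneg hα₀ hα₁ le_rfl (by positivity : 0 ≤ κ * t ^ α)
  rw [← neg_mul] at this
  unfold mlKernel
  positivity

theorem mlKernel_le {α κ t : ℝ} (hα₀ : 0 < α) (hα₁ : α < 1) (hκ : 0 ≤ κ) (ht : 0 ≤ t) :
    mlKernel α κ t ≤ rlKernel α t := by
  have := mittagLeffler_neg_le hα₀ hα₁ hα₀ (by positivity : 0 ≤ κ * t ^ α)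
  rw [← neg_mul] at this
  unfold mlKernel rlKernel
  rw [div_eq_mul_inv]
  gcongr

theorem intervalIntegrable_rlKernel {β : ℝ} (hβ : 0 < β) (a b : ℝ) :
    IntervalIntegrable (rlKernel β) volume a b :=
  (intervalIntegral.intervalIntegrable_rpow' (by linarith)).div_const _

theorem volterra_rlKernel_rlKernel {α β t : ℝ} (hα : 0 < α) (hβ : 0 < β) (ht : 0 < t) :
    volterra (rlKernel α) (rlKernel β) t = rlKernel (α + β) t := by
  have hα' := (Real.Gamma_pos_of_pos hα).ne'
  have hβ' := (Real.Gamma_pos_of_pos hβ).ne'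
  have h : ∀ s, rlKernel α (t - s) • rlKernel β s = (Real.Gamma α * Real.Gamma β)⁻¹ *
      ((t - s) ^ (α - 1) * s ^ (β - 1)) := fun s => by
    simp only [rlKernel, smul_eq_mul]
    field_simp
  simp_rw [volterra, h]
  rw [intervalIntegral.integral_const_mul, integral_sub_rpow_mul_rpow hα hβ ht, rlKernel]
  field_simp

theorem rlKernel_one {t : ℝ} : rlKernel 1 t = 1 := by simp [rlKernel]

theorem intervalIntegrable_rlKernel_mul_rlKernel {α β t : ℝ} (hα : 0 < α) (hβ : 0 < β) (ht : 0 < t) :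
    IntervalIntegrable (fun s => rlKernel α (t - s) * rlKernel β s) volume 0 t := by
  have := (intervalIntegrable_sub_rpow_mul_rpow hα hβ ht).const_mul (Real.Gamma α * Real.Gamma β)⁻¹
  refine this.congr fun s _ => ?_
  simp only [rlKernel, mul_inv]
  ring

theorem volterra_rlKernel_mlKernel {α β κ t : ℝ} (hα : 0 < α) (hβ : 0 < β) (ht : 0 < t) :
    volterra (rlKernel β) (mlKernel α κ) t =
      t ^ (β + α - 1) * mittagLeffler α (β + α) (-κ * t ^ α) := by
  have hβ' := (Real.Gamma_pos_of_pos hβ).ne'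
  have h : ∀ s, rlKernel β (t - s) • mlKernel α κ s = (Real.Gamma β)⁻¹ *
      ((t - s) ^ (β - 1) * (s ^ (α - 1) * mittagLeffler α α (-κ * s ^ α))) := fun s => by
    simp only [rlKernel, smul_eq_mul, mlKernel]
    field_simp
  simp_rw [volterra, h]
  rw [intervalIntegral.integral_const_mul, integral_sub_rpow_mul_mittagLeffler κ hα hβ hα ht]
  field_simp

theorem intervalIntegrable_rlKernel_mul_mlKernel {α β κ t : ℝ} (hα : 0 < α) (hβ : 0 < β)
    (ht : 0 < t) :
    IntervalIntegrable (fun s => rlKernel β (t - s) * mlKernel α κ s) volume 0 t := by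
  have := (intervalIntegrable_mul_mittagLeffler κ hα hβ hα ht).const_mul (Real.Gamma β)⁻¹
  refine this.congr fun s _ => ?_
  simp only [rlKernel, mlKernel]
  ring

/-- `I^(1-α)` maps the kernel `t ^ (α - 1) E_{α,α}(-κ t ^ α)` to `E_{α,1}(-κ t ^ α)`. -/
theorem volterra_one_sub_mlKernel {α κ t : ℝ} (hα₀ : 0 < α) (hα₁ : α < 1) (ht : 0 < t) :
    volterra (rlKernel (1 - α)) (mlKernel α κ) t = mittagLeffler α 1 (-κ * t ^ α) := by
  rw [volterra_rlKernel_mlKernel hα₀ (sub_pos.2 hα₁) ht]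
  simp

theorem mul_volterra_one_mlKernel {α κ t : ℝ} (hα : 0 < α) (ht : 0 < t) :
    κ * volterra (rlKernel 1) (mlKernel α κ) t = 1 - mittagLeffler α 1 (-κ * t ^ α) := by
  rw [volterra_rlKernel_mlKernel hα one_pos ht, mittagLeffler_eq_add_mul hα one_pos,
    add_comm α 1, add_sub_cancel_left]
  simp
  ring

/-! ### Associativity of convolution with singular kernels. -/

/-- Nonnegative kernels `a`, `b` with bounded convolution `a * b` on `(0,T]`. -/
structure BoundedConvolution (T C : ℝ) (a b : ℝ → ℝ) : Prop where
  measurable_left : Measurable a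
  measurable_right : Measurable b
  left_nonneg : ∀ t, 0 ≤ t → 0 ≤ a t
  right_nonneg : ∀ t, 0 ≤ t → 0 ≤ b t
  intervalIntegrable : ∀ t, 0 < t → IntervalIntegrable (fun s => a (t - s) * b s) volume 0 t
  le : ∀ t, 0 < t → t ≤ T → volterra a b t ≤ C

section Volterra

variable {E : Type*} [NormedAddCommGroup E] [NormedSpace ℝ E]

/-- Integrating the norm in the middle variable first leaves (a∗b)(t−r)‖g(r)‖ ≤ C‖g(r)‖, so
integrability of `g` suffices even though both kernels may be singular. -/
theorem BoundedConvolution.integrable_prod {T C t : ℝ} {a b : ℝ → ℝ} {g : ℝ → E}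
    (hab : BoundedConvolution T C a b) (hg : IntervalIntegrable g volume 0 T)
    (ht₀ : 0 ≤ t) (htT : t ≤ T) :
    Integrable (fun z : ℝ × ℝ => {z : ℝ × ℝ | z.2 ≤ z.1}.indicator
      (fun z => (a (t - z.1) * b (z.1 - z.2)) • g z.2) z)
      ((volume.restrict (Ioc 0 t)).prod (volume.restrict (Ioc 0 t))) := by
  have hg' : Integrable g (volume.restrict (Ioc 0 t)) := by
    rw [intervalIntegrable_iff_integrableOn_Ioc_of_le (ht₀.trans htT)] at hg
    exact hg.mono_set (Ioc_subset_Ioc_right htT)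
  have ham := hab.measurable_left
  have hbm := hab.measurable_right
  have hmeas : AEStronglyMeasurable (fun z : ℝ × ℝ => {z : ℝ × ℝ | z.2 ≤ z.1}.indicator
      (fun z => (a (t - z.1) * b (z.1 - z.2)) • g z.2) z)
      ((volume.restrict (Ioc 0 t)).prod (volume.restrict (Ioc 0 t))) := by
    refine AEStronglyMeasurable.indicator ?_ (measurableSet_le measurable_snd measurable_fst)
    refine AEStronglyMeasurable.smul ?_ hg'.1.comp_snd
    exact Measurable.aestronglyMeasurable (by fun_prop)
  have hsec : ∀ r ∈ Ioc 0 t, r ≠ t → IntegrableOn (fun s => {z : ℝ × ℝ | z.2 ≤ z.1}.indicator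
      (fun z => a (t - z.1) * b (z.1 - z.2)) (s, r)) (Ioc 0 t) ∧
      ∫ s in Ioc 0 t, {z : ℝ × ℝ | z.2 ≤ z.1}.indicator
        (fun z => a (t - z.1) * b (z.1 - z.2)) (s, r) = volterra a b (t - r) := by
    intro r hr hrt
    have hlt : r < t := lt_of_le_of_ne hr.2 hrt
    have hind : (fun s => {z : ℝ × ℝ | z.2 ≤ z.1}.indicator
        (fun z => a (t - z.1) * b (z.1 - z.2)) (s, r)) =
        (Ici r).indicator fun s => a (t - s) * b (s - r) := by
      funext s
      by_cases h : r ≤ s <;> simp [indicator, h]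
    have hset : Ioc 0 t ∩ Ici r = Icc r t := by
      ext s
      simp only [mem_inter_iff, mem_Ioc, mem_Ici, mem_Icc]
      have := hr.1
      constructor
      · rintro ⟨⟨_, h2⟩, h3⟩; exact ⟨h3, h2⟩
      · rintro ⟨h2, h3⟩; exact ⟨⟨by linarith, h3⟩, h2⟩
    rw [hind]
    constructor
    · rw [IntegrableOn, integrable_indicator_iff measurableSet_Ici, IntegrableOn,
        Measure.restrict_restrict measurableSet_Ici, inter_comm, hset]
      have := (hab.intervalIntegrable (t - r) (by linarith)).comp_sub_right r
      simp only [sub_sub_sub_cancel_right, zero_add, sub_add_cancel] at this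
      rw [intervalIntegrable_iff_integrableOn_Icc_of_le hlt.le] at this
      exact this
    · rw [setIntegral_indicator measurableSet_Ici, hset, integral_Icc_eq_integral_Ioc,
        ← intervalIntegral.integral_of_le hlt.le, volterra]
      have := intervalIntegral.integral_comp_sub_right (a := r) (b := t)
        (fun s => a (t - r - s) * b s) r
      simpa using this
  -- The hypotheses on a∗b concern positive times only, so the null set `r = t` is discarded.
  have hne : ∀ᵐ r ∂(volume.restrict (Ioc 0 t)), r ∈ Ioc 0 t ∧ r ≠ t := by
    filter_upwards [ae_restrict_mem measurableSet_Ioc,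
      ae_restrict_of_ae (Measure.ae_ne volume t)] with r h1 h2 using ⟨h1, h2⟩
  have hsmul : ∀ s r, {z : ℝ × ℝ | z.2 ≤ z.1}.indicator
      (fun z => (a (t - z.1) * b (z.1 - z.2)) • g z.2) (s, r) =
      ({z : ℝ × ℝ | z.2 ≤ z.1}.indicator (fun z => a (t - z.1) * b (z.1 - z.2)) (s, r)) • g r := by
    intro s r
    by_cases h : r ≤ s <;> simp [indicator, h]
  refine (integrable_prod_iff' hmeas).2 ⟨?_, ?_⟩
  · filter_upwards [hne] with r hr
    simp_rw [hsmul]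
    exact Integrable.smul_const (hsec r hr.1 hr.2).1 _
  · refine (hg'.norm.const_mul C).mono' hmeas.norm.prod_swap.integral_prod_right' ?_
    filter_upwards [hne] with r hr
    have hlt : r < t := lt_of_le_of_ne hr.1.2 hr.2
    have heq : ∫ s in Ioc 0 t, ‖{z : ℝ × ℝ | z.2 ≤ z.1}.indicator
        (fun z => (a (t - z.1) * b (z.1 - z.2)) • g z.2) (s, r)‖ = volterra a b (t - r) * ‖g r‖ := by
      rw [← (hsec r hr.1 hr.2).2, ← integral_mul_const]
      refine setIntegral_congr_fun measurableSet_Ioc fun s hs => ?_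
      simp only [hsmul]
      rw [norm_smul, Real.norm_of_nonneg]
      refine indicator_apply_nonneg fun h => ?_
      exact mul_nonneg (hab.left_nonneg _ (by linarith [hs.2]))
        (hab.right_nonneg _ (sub_nonneg.2 h))
    rw [heq, Real.norm_of_nonneg]
    · exact mul_le_mul_of_nonneg_right (hab.le _ (by linarith) (by linarith [hr.1.1]))
        (norm_nonneg _)
    · refine mul_nonneg (intervalIntegral.integral_nonneg (by linarith) fun s hs => ?_) (norm_nonneg _)
      exact mul_nonneg (hab.left_nonneg _ (by linarith [hs.2])) (hab.right_nonneg _ hs.1)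

theorem integral_indicator_section (a b : ℝ → ℝ) (g : ℝ → E) {s t : ℝ} (hs : s ∈ Ioc 0 t) :
    ∫ r in Ioc 0 t, {z : ℝ × ℝ | z.2 ≤ z.1}.indicator
      (fun z => (a (t - z.1) * b (z.1 - z.2)) • g z.2) (s, r) = a (t - s) • volterra b g s := by
  have hind : (fun r => {z : ℝ × ℝ | z.2 ≤ z.1}.indicator
      (fun z => (a (t - z.1) * b (z.1 - z.2)) • g z.2) (s, r)) =
      (Iic s).indicator fun r => a (t - s) • b (s - r) • g r := by
    funext r
    by_cases h : r ≤ s <;> simp [indicator, h, smul_smul]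
  have hset : Ioc 0 t ∩ Iic s = Ioc 0 s := by
    ext r
    simp only [mem_inter_iff, mem_Ioc, mem_Iic]
    have := hs.2
    constructor
    · rintro ⟨⟨h1, _⟩, h3⟩; exact ⟨h1, h3⟩
    · rintro ⟨h1, h2⟩; exact ⟨⟨h1, by linarith⟩, h2⟩
  rw [hind, setIntegral_indicator measurableSet_Iic, hset, integral_smul, volterra,
    intervalIntegral.integral_of_le hs.1.le]

theorem BoundedConvolution.intervalIntegrable_volterra {T C t : ℝ} {a b : ℝ → ℝ} {g : ℝ → E}
    (hab : BoundedConvolution T C a b) (hg : IntervalIntegrable g volume 0 T)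
    (ht₀ : 0 ≤ t) (htT : t ≤ T) :
    IntervalIntegrable (fun s => a (t - s) • volterra b g s) volume 0 t := by
  rw [intervalIntegrable_iff_integrableOn_Ioc_of_le ht₀]
  refine (hab.integrable_prod hg ht₀ htT).integral_prod_left.congr ?_
  filter_upwards [ae_restrict_mem measurableSet_Ioc] with s hs
  exact integral_indicator_section a b g hs

/-- Almost every section of the Fubini integrand at the final time is integrable; on it `a (T - s)`
is a nonzero constant and can be divided out. -/
theorem BoundedConvolution.ae_intervalIntegrable {T C : ℝ} {a b : ℝ → ℝ} {g : ℝ → E}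
    (hab : BoundedConvolution T C a b) (ha : ∀ t, 0 < t → t ≤ T → a t ≠ 0)
    (hg : IntervalIntegrable g volume 0 T) (hT : 0 ≤ T) :
    ∀ᵐ s ∂(volume.restrict (Ioc 0 T)),
      IntervalIntegrable (fun r => b (s - r) • g r) volume 0 s := by
  filter_upwards [(hab.integrable_prod hg hT le_rfl).prod_right_ae,
    ae_restrict_mem measurableSet_Ioc, ae_restrict_of_ae (Measure.ae_ne volume T)] with s h hs hsT
  have h0 : a (T - s) ≠ 0 :=
    ha _ (sub_pos.2 (lt_of_le_of_ne hs.2 hsT)) (by linarith [hs.1])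
  rw [intervalIntegrable_iff_integrableOn_Ioc_of_le hs.1.le]
  have h1 : IntegrableOn (fun r => (a (T - s) * b (s - r)) • g r) (Ioc 0 s) := by
    refine (IntegrableOn.mono_set h (Ioc_subset_Ioc_right hs.2)).congr_fun (fun r hr => ?_)
      measurableSet_Ioc
    simp [indicator, hr.2]
  refine IntegrableOn.congr_fun (Integrable.smul (a (T - s))⁻¹ h1) (fun r _ => ?_) measurableSet_Ioc
  simp [smul_smul, h0]

theorem BoundedConvolution.volterra_volterra [CompleteSpace E] {T C t : ℝ} {a b : ℝ → ℝ} {g : ℝ → E}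
    (hab : BoundedConvolution T C a b) (hg : IntervalIntegrable g volume 0 T)
    (ht₀ : 0 ≤ t) (htT : t ≤ T) :
    volterra a (volterra b g) t = volterra (volterra a b) g t := by
  have h := integral_integral_swap
    (f := fun s r => {z : ℝ × ℝ | z.2 ≤ z.1}.indicator
      (fun z => (a (t - z.1) * b (z.1 - z.2)) • g z.2) (s, r)) (hab.integrable_prod hg ht₀ htT)
  rw [volterra, intervalIntegral.integral_of_le ht₀, volterra, intervalIntegral.integral_of_le ht₀]
  rw [setIntegral_congr_fun measurableSet_Ioc fun s hs =>
    (integral_indicator_section a b g hs).symm, h]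
  refine integral_congr_ae ?_
  filter_upwards [ae_restrict_mem measurableSet_Ioc,
      ae_restrict_of_ae (Measure.ae_ne volume t)] with r hr hrt
  have hlt : r < t := lt_of_le_of_ne hr.2 hrt
  have hind : (fun s => {z : ℝ × ℝ | z.2 ≤ z.1}.indicator
      (fun z => (a (t - z.1) * b (z.1 - z.2)) • g z.2) (s, r)) =
      (Ici r).indicator fun s => (a (t - s) * b (s - r)) • g r := by
    funext s
    by_cases h : r ≤ s <;> simp [indicator, h]
  have hset : Ioc 0 t ∩ Ici r = Icc r t := by
    ext s
    simp only [mem_inter_iff, mem_Ioc, mem_Ici, mem_Icc]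
    have := hr.1
    constructor
    · rintro ⟨⟨_, h2⟩, h3⟩; exact ⟨h3, h2⟩
    · rintro ⟨h2, h3⟩; exact ⟨⟨by linarith, h3⟩, h2⟩
  rw [hind, setIntegral_indicator measurableSet_Ici, hset, integral_Icc_eq_integral_Ioc,
    ← intervalIntegral.integral_of_le hlt.le, intervalIntegral.integral_smul_const, volterra]
  have := intervalIntegral.integral_comp_sub_right (a := r) (b := t)
    (fun s => a (t - r - s) * b s) r
  simp only [sub_sub_sub_cancel_right, sub_self] at this
  rw [this]
  rfl

theorem volterra_congr {a b : ℝ → ℝ} {g h : ℝ → E} {t : ℝ} (ht : 0 ≤ t)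
    (hab : ∀ s, 0 < s → s ≤ t → a s = b s) (hgh : ∀ᵐ s ∂(volume.restrict (Ioc 0 t)), g s = h s) :
    volterra a g t = volterra b h t := by
  rw [volterra, volterra, intervalIntegral.integral_of_le ht, intervalIntegral.integral_of_le ht]
  refine integral_congr_ae ?_
  filter_upwards [hgh, ae_restrict_mem measurableSet_Ioc,
    ae_restrict_of_ae (Measure.ae_ne volume t)] with s h1 h2 h3
  rw [h1, hab _ (sub_pos.2 (lt_of_le_of_ne h2.2 h3)) (by linarith [h2.1])]

theorem volterra_rlKernel_one (g : ℝ → E) (t : ℝ) :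
    volterra (rlKernel 1) g t = ∫ s in (0 : ℝ)..t, g s := by
  simp [volterra, rlKernel]

theorem norm_volterra_le {a : ℝ → ℝ} {g : ℝ → E} {h : ℝ → ℝ} {t : ℝ} (ht : 0 ≤ t)
    (ha : ∀ s, 0 ≤ s → 0 ≤ a s) (hgh : ∀ᵐ s ∂(volume.restrict (Ioc 0 t)), ‖g s‖ ≤ h s)
    (hh : IntervalIntegrable (fun s => a (t - s) * h s) volume 0 t) :
    ‖volterra a g t‖ ≤ volterra a h t := by
  refine intervalIntegral.norm_integral_le_of_norm_le ht ?_ hh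
  rw [ae_restrict_iff' measurableSet_Ioc] at hgh
  filter_upwards [hgh] with s hs hst
  rw [norm_smul, Real.norm_of_nonneg (ha _ (by linarith [hst.2]))]
  exact mul_le_mul_of_nonneg_left (hs hst) (ha _ (by linarith [hst.2]))

end Volterra

/-! ### Kernel pairs of total order at least one. -/

theorem boundedConvolution_rlKernel_rlKernel {α β : ℝ} (hα : 0 < α) (hβ : 0 < β) (h : 1 ≤ α + β)
    (T : ℝ) :
    BoundedConvolution T (rlKernel (α + β) T) (rlKernel α) (rlKernel β) where
  measurable_left := measurable_rlKernel _
  measurable_right := measurable_rlKernel _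
  left_nonneg _ ht := rlKernel_nonneg hα ht
  right_nonneg _ ht := rlKernel_nonneg hβ ht
  intervalIntegrable t ht := intervalIntegrable_rlKernel_mul_rlKernel hα hβ ht
  le t ht htT := by
    rw [volterra_rlKernel_rlKernel hα hβ ht]
    have := Real.Gamma_pos_of_pos (add_pos hα hβ)
    unfold rlKernel
    have : 0 ≤ α + β - 1 := by linarith
    gcongr

theorem boundedConvolution_rlKernel_mlKernel {α β κ : ℝ} (hα₀ : 0 < α) (hα₁ : α < 1) (hβ : 0 < β)
    (h : 1 ≤ β + α) (hκ : 0 ≤ κ) (T : ℝ) :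
    BoundedConvolution T (rlKernel (β + α) T) (rlKernel β) (mlKernel α κ) where
  measurable_left := measurable_rlKernel _
  measurable_right := measurable_mlKernel hα₀ _
  left_nonneg _ ht := rlKernel_nonneg hβ ht
  right_nonneg _ ht := mlKernel_nonneg hα₀ hα₁ hκ ht
  intervalIntegrable t ht := intervalIntegrable_rlKernel_mul_mlKernel hα₀ hβ ht
  le t ht htT := by
    refine le_trans ?_ ((boundedConvolution_rlKernel_rlKernel hβ hα₀ h T).le t ht htT)
    refine intervalIntegral.integral_mono_on ht.le
      (intervalIntegrable_rlKernel_mul_mlKernel hα₀ hβ ht)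
      (intervalIntegrable_rlKernel_mul_rlKernel hβ hα₀ ht) fun s hs => ?_
    exact mul_le_mul_of_nonneg_left (mlKernel_le hα₀ hα₁ hκ hs.1)
      (rlKernel_nonneg hβ (by linarith [hs.2]))

/-! ### Uniqueness for the homogeneous fractional equation. -/

section Uniqueness

variable {E : Type*} [NormedAddCommGroup E] [NormedSpace ℝ E]

theorem HasTimeDeriv.continuousOn {T : ℝ} {g g' : ℝ → E} (hT : 0 ≤ T) (h : HasTimeDeriv T g g') :
    ContinuousOn g (Icc 0 T) := by
  have h1 := intervalIntegral.continuousOn_primitive_interval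
    ((intervalIntegrable_iff_integrableOn_Icc_of_le hT).1 h.1 |>.mono_set (uIcc_of_le hT).le)
  rw [uIcc_of_le hT] at h1
  exact (continuousOn_const.add h1).congr h.2

/-- The Cauchy problem `D^α d = -κ d`, `d(0) = 0`, has only the trivial solution. -/
theorem HasTimeDeriv.eq_zero_of_fracIntegral_eq [CompleteSpace E] {α κ T : ℝ} (hα₀ : 0 < α) (hα₁ : α < 1)
    {d d' : ℝ → E} (hd : HasTimeDeriv T d d') (h0 : d 0 = 0)
    (h : ∀ᵐ t ∂(volume.restrict (Icc 0 T)), fracIntegral (1 - α) d' t = -(κ • d t)) :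
    ∀ t ∈ Icc 0 T, d t = 0 := by
  intro t ht
  have hT : 0 ≤ T := ht.1.trans ht.2
  obtain ⟨B, hB⟩ := isCompact_Icc.exists_bound_of_continuousOn (hd.continuousOn hT)
  have hB0 : 0 ≤ B := (norm_nonneg _).trans (hB 0 ⟨le_rfl, hT⟩)
  have h1α : 0 < 1 - α := sub_pos.2 hα₁
  have hconv := boundedConvolution_rlKernel_rlKernel hα₀ h1α (by linarith) T
  -- I^α inverts the equation: d = I^1 d' = I^α I^(1−α) d'.
  have hdeq : ∀ s ∈ Icc 0 T, d s = volterra (rlKernel α) (fun r => -(κ • d r)) s := by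
    intro s hs
    rw [hd.2 s hs, h0, zero_add, ← volterra_rlKernel_one]
    have h2 : volterra (rlKernel α) (fun r => -(κ • d r)) s =
        volterra (rlKernel α) (volterra (rlKernel (1 - α)) d') s := by
      refine volterra_congr hs.1 (fun _ _ _ => rfl) ?_
      have h3 := ae_restrict_of_ae_restrict_of_subset
        (Ioc_subset_Icc_self.trans (Icc_subset_Icc_right hs.2)) h
      filter_upwards [h3] with r hr
      rw [← hr, fracIntegral_eq_volterra h1α.ne']
    rw [h2, hconv.volterra_volterra hd.1 hs.1 hs.2]
    refine volterra_congr hs.1 (fun r hr _ => ?_) (Filter.Eventually.of_forall fun _ => rfl)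
    rw [volterra_rlKernel_rlKernel hα₀ h1α hr]
    simp
  -- By the semigroup law each use of `hdeq` raises the order of the kernel by `α`; the bound is
  -- then `B` times a term of the series for E_{α,1}(|κ|s^α).
  have hbound : ∀ n : ℕ, ∀ s ∈ Icc 0 T, ‖d s‖ ≤ B * |κ| ^ n * rlKernel (α * n + 1) s := by
    intro n
    induction n with
    | zero =>
      intro s hs
      simpa [rlKernel] using hB s hs
    | succ n ih =>
      intro s hs
      have hn : 0 < α * n + 1 := by positivity
      rcases hs.1.eq_or_lt with rfl | hs0
      · rw [h0, norm_zero]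
        have := rlKernel_nonneg (β := α * (n + 1 : ℕ) + 1) (by positivity) le_rfl
        positivity
      have hi : IntervalIntegrable (fun r => rlKernel α (s - r) *
          (B * |κ| ^ (n + 1) * rlKernel (α * n + 1) r)) volume 0 s := by
        refine ((intervalIntegrable_rlKernel_mul_rlKernel hα₀ hn hs0).const_mul
          (B * |κ| ^ (n + 1))).congr fun r _ => ?_
        ring
      rw [hdeq s hs]
      refine (norm_volterra_le (h := fun r => B * |κ| ^ (n + 1) * rlKernel (α * n + 1) r) hs.1
        (fun _ => rlKernel_nonneg hα₀) ?_ hi).trans ?_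
      · filter_upwards [ae_restrict_mem measurableSet_Ioc] with r hr
        rw [norm_neg, norm_smul, Real.norm_eq_abs]
        have := ih r ⟨hr.1.le, hr.2.trans hs.2⟩
        calc |κ| * ‖d r‖ ≤ |κ| * (B * |κ| ^ n * rlKernel (α * n + 1) r) := by gcongr
          _ = _ := by ring
      · have h5 : volterra (rlKernel α) (fun r => B * |κ| ^ (n + 1) * rlKernel (α * n + 1) r) s =
            B * |κ| ^ (n + 1) * volterra (rlKernel α) (rlKernel (α * n + 1)) s := by
          rw [volterra, volterra, ← intervalIntegral.integral_const_mul]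
          refine intervalIntegral.integral_congr fun r _ => ?_
          simp only [smul_eq_mul]
          ring
        rw [h5, volterra_rlKernel_rlKernel hα₀ hn hs0]
        push_cast
        rw [show α + (α * n + 1) = α * (n + 1) + 1 by ring]
  rcases ht.1.eq_or_lt with rfl | ht0
  · exact h0
  have hlim : Filter.Tendsto (fun n : ℕ => B * |κ| ^ n * rlKernel (α * n + 1) t) Filter.atTop
      (nhds 0) := by
    have := ((summable_mittagLeffler hα₀ one_pos (|κ| * t ^ α)).tendsto_atTop_zero).const_mul B
    rw [mul_zero] at this
    refine this.congr fun n => ?_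
    rw [rlKernel, add_sub_cancel_right, mul_pow, ← Real.rpow_natCast (t ^ α),
      ← Real.rpow_mul ht.1]
    ring
  exact norm_le_zero_iff.1 (ge_of_tendsto' hlim fun n => hbound n t ht)

end Uniqueness

/-! ### Diagonal operators and coordinatewise measurability. -/

section Hilbert

variable {𝕜 H I : Type*} [RCLike 𝕜] [NormedAddCommGroup H] [InnerProductSpace 𝕜 H]

theorem HilbertBasis.ext_inner (e : HilbertBasis I 𝕜 H) {x y : H}
    (h : ∀ ξ, ⟪e ξ, x⟫_𝕜 = ⟪e ξ, y⟫_𝕜) : x = y := by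
  apply e.repr.injective
  ext ξ
  simpa [e.repr_apply_apply] using h ξ

theorem HilbertBasis.hasSum_inner_smul (e : HilbertBasis I 𝕜 H) (x : H) :
    HasSum (fun ξ => ⟪e ξ, x⟫_𝕜 • e ξ) x := by
  simpa [e.repr_apply_apply] using e.hasSum_repr x

theorem HilbertBasis.exists_inner_eq (e : HilbertBasis I 𝕜 H) {C : ℝ} (hC : 0 ≤ C) (x : H)
    {c : I → 𝕜} (hc : ∀ ξ, ‖c ξ‖ ≤ C * ‖⟪e ξ, x⟫_𝕜‖) :
    ∃ y : H, (∀ ξ, ⟪e ξ, y⟫_𝕜 = c ξ) ∧ ‖y‖ ≤ C * ‖x‖ := by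
  have hle : ∀ ξ, ‖c ξ‖ ≤ ‖e.repr ((C : 𝕜) • x) ξ‖ := by
    intro ξ
    rw [e.repr_apply_apply, inner_smul_right, norm_mul, RCLike.norm_ofReal, abs_of_nonneg hC]
    exact hc ξ
  have hmem : Memℓp c 2 := (lp.memℓp (e.repr ((C : 𝕜) • x))).mono' hle
  let z : lp (fun _ : I => 𝕜) 2 := ⟨c, hmem⟩
  refine ⟨e.repr.symm z, fun ξ => ?_, ?_⟩
  · rw [← e.repr_apply_apply, LinearIsometryEquiv.apply_symm_apply]
  · have h1 : ‖z‖ ≤ ‖e.repr ((C : 𝕜) • x)‖ := lp.norm_mono (by simp) hle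
    rw [LinearIsometryEquiv.norm_map, norm_smul, RCLike.norm_ofReal, abs_of_nonneg hC] at h1
    rwa [LinearIsometryEquiv.norm_map]

theorem HilbertBasis.summable_smul (e : HilbertBasis I 𝕜 H) {C : ℝ} (hC : 0 ≤ C) (x : H)
    {c : I → 𝕜} (hc : ∀ ξ, ‖c ξ‖ ≤ C * ‖⟪e ξ, x⟫_𝕜‖) : Summable fun ξ => c ξ • e ξ := by
  obtain ⟨y, hy, _⟩ := e.exists_inner_eq hC x hc
  simpa only [hy] using (e.hasSum_inner_smul y).summable

/-- Bounded diagonal operators. -/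
theorem HilbertBasis.exists_diagonal (e : HilbertBasis I 𝕜 H) {m : I → ℝ} {C : ℝ}
    (hC : 0 ≤ C) (hm : ∀ ξ, |m ξ| ≤ C) :
    ∃ D : H →L[𝕜] H, (∀ x ξ, ⟪e ξ, D x⟫_𝕜 = (m ξ : 𝕜) * ⟪e ξ, x⟫_𝕜) ∧ ∀ x, ‖D x‖ ≤ C * ‖x‖ := by
  have h : ∀ x : H, ∃ y : H, (∀ ξ, ⟪e ξ, y⟫_𝕜 = (m ξ : 𝕜) * ⟪e ξ, x⟫_𝕜) ∧ ‖y‖ ≤ C * ‖x‖ :=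
    fun x => e.exists_inner_eq hC x fun ξ => by
      rw [norm_mul, RCLike.norm_ofReal]
      exact mul_le_mul_of_nonneg_right (hm ξ) (norm_nonneg _)
  choose D hD hb using h
  let D₀ : H →ₗ[𝕜] H :=
    { toFun := D
      map_add' := fun x y => e.ext_inner fun ξ => by
        simp only [hD, inner_add_right, mul_add]
      map_smul' := fun c x => e.ext_inner fun ξ => by
        simp only [hD, inner_smul_right, RingHom.id_apply]
        ring }
  exact ⟨D₀.mkContinuous C hb, hD, hb⟩

/-- Countability of `I` makes the finite subsets a countably generated direction, so the limit of
the partial Fourier sums stays measurable. -/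
theorem HilbertBasis.aestronglyMeasurable_of_inner [Countable I] (e : HilbertBasis I 𝕜 H)
    {Ω : Type*} [MeasurableSpace Ω] {ν : Measure Ω} {g : Ω → H}
    (h : ∀ ξ, AEStronglyMeasurable (fun t => ⟪e ξ, g t⟫_𝕜) ν) : AEStronglyMeasurable g ν := by
  refine aestronglyMeasurable_of_tendsto_ae Filter.atTop
    (f := fun (s : Finset I) t => ∑ ξ ∈ s, ⟪e ξ, g t⟫_𝕜 • e ξ) (fun s => ?_)
    (Filter.Eventually.of_forall fun t => e.hasSum_inner_smul (g t))
  exact Finset.aestronglyMeasurable_fun_sum s fun ξ _ => (h ξ).smul_const (e ξ)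

theorem IntervalIntegrable.clm_comp {F : Type*} [NormedAddCommGroup F] [NormedSpace 𝕜 F]
    (D : H →L[𝕜] F) {g : ℝ → H} {a b : ℝ} (hg : IntervalIntegrable g volume a b) :
    IntervalIntegrable (fun s => D (g s)) volume a b :=
  ⟨D.integrable_comp hg.1, D.integrable_comp hg.2⟩

variable [NormedSpace ℝ H] [CompleteSpace H]

theorem intervalIntegral_clm_comp_comm {F : Type*} [NormedAddCommGroup F] [NormedSpace 𝕜 F]
    [NormedSpace ℝ F] [CompleteSpace F]
    (D : H →L[𝕜] F) {g : ℝ → H} {a b : ℝ} (hg : IntervalIntegrable g volume a b) :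
    ∫ s in a..b, D (g s) = D (∫ s in a..b, g s) :=
  ContinuousLinearMap.intervalIntegral_comp_comm D hg

theorem clm_volterra {F : Type*} [NormedAddCommGroup F] [NormedSpace 𝕜 F]
    [NormedSpace ℝ F] [CompleteSpace F]
    (D : H →L[𝕜] F) {a : ℝ → ℝ} {g : ℝ → H} {t : ℝ}
    (hg : IntervalIntegrable (fun s => a (t - s) • g s) volume 0 t) :
    D (volterra a g t) = volterra a (fun s => D (g s)) t := by
  rw [volterra, ← intervalIntegral_clm_comp_comm D hg]
  refine intervalIntegral.integral_congr fun s _ => ?_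
  -- `D` is only `𝕜`-linear; additivity and continuity give real homogeneity.
  exact map_real_smul D.toLinearMap.toAddMonoidHom D.continuous _ _

theorem HasTimeDeriv.clm_comp {F : Type*} [NormedAddCommGroup F] [NormedSpace 𝕜 F]
    [NormedSpace ℝ F] [CompleteSpace F] {T : ℝ}
    (D : H →L[𝕜] F) {g g' : ℝ → H} (h : HasTimeDeriv T g g') :
    HasTimeDeriv T (fun t => D (g t)) (fun t => D (g' t)) := by
  refine ⟨h.1.clm_comp D, fun t ht => ?_⟩
  change D (g t) = D (g 0) + _
  rw [intervalIntegral_clm_comp_comm D, h.2 t ht, map_add]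
  refine h.1.mono_set ?_
  rw [uIcc_of_le ht.1, uIcc_of_le (ht.1.trans ht.2)]
  exact Icc_subset_Icc_right ht.2

end Hilbert

/-! ### Consequences for fractional integrals. -/

section Convolution

variable {E : Type*} [NormedAddCommGroup E] [NormedSpace ℝ E]

/-- The left kernel of order one is the constant 1, so it never vanishes and the total order 1 + β
exceeds one. -/
theorem ae_intervalIntegrable_rlKernel {β T : ℝ} (hβ : 0 < β) (hT : 0 ≤ T) {g : ℝ → E}
    (hg : IntervalIntegrable g volume 0 T) :
    ∀ᵐ t ∂(volume.restrict (Ioc 0 T)),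
      IntervalIntegrable (fun s => rlKernel β (t - s) • g s) volume 0 t :=
  (boundedConvolution_rlKernel_rlKernel one_pos hβ (by linarith) T).ae_intervalIntegrable
    (fun _ _ _ => by simp [rlKernel]) hg hT

theorem BoundedConvolution.intervalIntegrable_volterra_right {T C : ℝ} {b : ℝ → ℝ} {g : ℝ → E}
    (hb : BoundedConvolution T C (rlKernel 1) b) (hg : IntervalIntegrable g volume 0 T)
    (hT : 0 ≤ T) : IntervalIntegrable (volterra b g) volume 0 T := by
  simpa [rlKernel] using hb.intervalIntegrable_volterra hg hT le_rfl

/-- Serves both for the exact coordinates of the response (`b` a Mittag-Leffler kernel) and for its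
norm majorant (`b` a power kernel). -/
theorem BoundedConvolution.volterra_resolvent [CompleteSpace E] {T C t : ℝ} {a b : ℝ → ℝ} {g q : ℝ → E} {c : E}
    (hab : BoundedConvolution T C a b) (hg : IntervalIntegrable g volume 0 T)
    (hq : ∀ᵐ s ∂(volume.restrict (Ioc 0 T)), q s = b s • c + volterra b g s)
    (ht₀ : 0 < t) (htT : t ≤ T) :
    IntervalIntegrable (fun s => a (t - s) • q s) volume 0 t ∧
    volterra a q t = volterra a b t • c + volterra (volterra a b) g t := by
  have hq' : ∀ᵐ s ∂(volume.restrict (Ioc 0 t)), q s = b s • c + volterra b g s :=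
    ae_restrict_of_ae_restrict_of_subset (Ioc_subset_Ioc_right htT) hq
  have h1 : IntervalIntegrable (fun s => a (t - s) • b s • c) volume 0 t := by
    simp_rw [smul_smul]
    exact (intervalIntegrable_iff.2 <| ((intervalIntegrable_iff.1
      (hab.intervalIntegrable t ht₀))).smul_const c)
  have h2 := hab.intervalIntegrable_volterra hg ht₀.le htT
  have hae : ∀ᵐ s ∂(volume.restrict (Ioc 0 t)),
      a (t - s) • q s = a (t - s) • b s • c + a (t - s) • volterra b g s := by
    filter_upwards [hq'] with s hs
    rw [hs, smul_add]
  constructor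
  · rw [intervalIntegrable_iff_integrableOn_Ioc_of_le ht₀.le] at h1 h2 ⊢
    exact (h1.add h2).congr (hae.mono fun s hs => hs.symm)
  · rw [← hab.volterra_volterra hg ht₀.le htT, volterra, intervalIntegral.integral_of_le ht₀.le,
      integral_congr_ae hae, ← intervalIntegral.integral_of_le ht₀.le,
      intervalIntegral.integral_add h1 h2]
    congr 1
    simp_rw [smul_smul]
    rw [intervalIntegral.integral_smul_const]
    rfl

theorem HasTimeDeriv.sub {T : ℝ}
    {g g' h h' : ℝ → E} (hg : HasTimeDeriv T g g') (hh : HasTimeDeriv T h h') :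
    HasTimeDeriv T (fun t => g t - h t) (fun t => g' t - h' t) := by
  refine ⟨hg.1.sub hh.1, fun t ht => ?_⟩
  have hsub : uIcc 0 t ⊆ uIcc 0 T := by
    rw [uIcc_of_le ht.1, uIcc_of_le (ht.1.trans ht.2)]
    exact Icc_subset_Icc_right ht.2
  rw [intervalIntegral.integral_sub (hg.1.mono_set hsub) (hh.1.mono_set hsub)]
  simp only [hg.2 t ht, hh.2 t ht]
  abel

end Convolution

/-! ### The vector-valued response. -/

section Hilbert

variable {𝕜 H I : Type*} [RCLike 𝕜] [NormedAddCommGroup H] [InnerProductSpace 𝕜 H]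
  [NormedSpace ℝ H] [CompleteSpace H]

/-- The function `q(t) = P(t) c + ∫_0^t P(t - s) g(s) ds` for the diagonal operators `P(t)` with
entries `t ^ (α - 1) E_{α,α}(-κ_ξ t ^ α)`. -/
theorem HilbertBasis.exists_mlKernel_response [Countable I] (e : HilbertBasis I 𝕜 H) {α T : ℝ}
    (hα₀ : 0 < α) (hα₁ : α < 1) (hT : 0 ≤ T) {κ : I → ℝ} (hκ : ∀ ξ, 0 ≤ κ ξ) (c : H) {g : ℝ → H}
    (hg : IntervalIntegrable g volume 0 T) :
    ∃ q : ℝ → H, IntervalIntegrable q volume 0 T ∧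
      (∀ᵐ t ∂(volume.restrict (Ioc 0 T)),
        ‖q t‖ ≤ rlKernel α t • ‖c‖ + volterra (rlKernel α) (fun s => ‖g s‖) t) ∧
      ∀ᵐ t ∂(volume.restrict (Ioc 0 T)), ∀ ξ, ⟪e ξ, q t⟫_𝕜 =
        mlKernel α (κ ξ) t • ⟪e ξ, c⟫_𝕜 + volterra (mlKernel α (κ ξ)) (fun s => ⟪e ξ, g s⟫_𝕜) t := by
  -- The norm bound does not involve `κ`, which is what allows unbounded eigenvalue ratios. Negative
  -- times get the dummy value 0.
  have hP : ∀ τ : ℝ, ∃ D : H →L[𝕜] H, 0 ≤ τ →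
      (∀ x ξ, ⟪e ξ, D x⟫_𝕜 = mlKernel α (κ ξ) τ • ⟪e ξ, x⟫_𝕜) ∧
      ∀ x, ‖D x‖ ≤ rlKernel α τ * ‖x‖ := fun τ => by
    by_cases hτ : 0 ≤ τ
    · obtain ⟨D, hD, hb⟩ := e.exists_diagonal (m := fun ξ => mlKernel α (κ ξ) τ)
        (rlKernel_nonneg hα₀ hτ) fun ξ => by
          rw [abs_of_nonneg (mlKernel_nonneg hα₀ hα₁ (hκ ξ) hτ)]
          exact mlKernel_le hα₀ hα₁ (hκ ξ) hτ
      exact ⟨D, fun _ => ⟨fun x ξ => by rw [hD, RCLike.real_smul_eq_coe_mul], hb⟩⟩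
    · exact ⟨0, fun h => absurd h hτ⟩
  choose P hP using hP
  have hgξ : ∀ ξ, IntervalIntegrable (fun s => ⟪e ξ, g s⟫_𝕜) volume 0 T :=
    fun ξ => hg.clm_comp (innerSL 𝕜 (e ξ))
  have hconv := ae_intervalIntegrable_rlKernel hα₀ hT hg.norm
  have hint : ∀ᵐ t ∂(volume.restrict (Ioc 0 T)),
      IntervalIntegrable (fun s => P (t - s) (g s)) volume 0 t ∧
      ‖∫ s in (0 : ℝ)..t, P (t - s) (g s)‖ ≤ volterra (rlKernel α) (fun s => ‖g s‖) t := by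
    filter_upwards [hconv, ae_restrict_mem measurableSet_Ioc] with t ht htT
    have hb : ∀ᵐ s ∂(volume.restrict (Ioc 0 t)),
        ‖P (t - s) (g s)‖ ≤ rlKernel α (t - s) • ‖g s‖ := by
      filter_upwards [ae_restrict_mem measurableSet_Ioc] with s hs
      exact (hP (t - s) (sub_nonneg.2 hs.2)).2 _
    -- Measurability of `P` in time is never proved; the coordinates of the integrand are visibly
    -- measurable.
    have hm : AEStronglyMeasurable (fun s => P (t - s) (g s)) (volume.restrict (Ioc 0 t)) := by
      refine e.aestronglyMeasurable_of_inner fun ξ => ?_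
      have h1 : AEStronglyMeasurable (fun s => ⟪e ξ, g s⟫_𝕜) (volume.restrict (Ioc 0 t)) := by
        have := (intervalIntegrable_iff_integrableOn_Ioc_of_le hT).1 (hgξ ξ)
        exact (this.mono_set (Ioc_subset_Ioc_right htT.2)).1
      have h2 : AEStronglyMeasurable (fun s => mlKernel α (κ ξ) (t - s))
          (volume.restrict (Ioc 0 t)) :=
        ((measurable_mlKernel hα₀ (κ ξ)).comp (measurable_const.sub measurable_id)).aestronglyMeasurable
      refine (h2.smul h1).congr ?_
      filter_upwards [ae_restrict_mem measurableSet_Ioc] with s hs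
      exact ((hP (t - s) (sub_nonneg.2 hs.2)).1 _ ξ).symm
    refine ⟨?_, ?_⟩
    · rw [intervalIntegrable_iff_integrableOn_Ioc_of_le htT.1.le] at ht ⊢
      exact Integrable.mono' ht hm hb
    · rw [ae_restrict_iff' measurableSet_Ioc] at hb
      exact intervalIntegral.norm_integral_le_of_norm_le htT.1.le hb ht
  have hbound : ∀ᵐ t ∂(volume.restrict (Ioc 0 T)),
      ‖P t c + ∫ s in (0 : ℝ)..t, P (t - s) (g s)‖ ≤
        rlKernel α t • ‖c‖ + volterra (rlKernel α) (fun s => ‖g s‖) t := by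
    filter_upwards [hint, ae_restrict_mem measurableSet_Ioc] with t ht htT
    exact (norm_add_le _ _).trans (add_le_add ((hP t htT.1.le).2 c) ht.2)
  have hcoef : ∀ᵐ t ∂(volume.restrict (Ioc 0 T)), ∀ ξ,
      ⟪e ξ, P t c + ∫ s in (0 : ℝ)..t, P (t - s) (g s)⟫_𝕜 =
        mlKernel α (κ ξ) t • ⟪e ξ, c⟫_𝕜 +
          volterra (mlKernel α (κ ξ)) (fun s => ⟪e ξ, g s⟫_𝕜) t := by
    filter_upwards [hint, ae_restrict_mem measurableSet_Ioc] with t ht htT ξ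
    rw [inner_add_right, (hP t htT.1.le).1]
    congr 1
    have := intervalIntegral_clm_comp_comm (innerSL 𝕜 (e ξ)) ht.1
    simp only [innerSL_apply_apply] at this
    rw [← this]
    refine intervalIntegral.integral_congr fun s hs => ?_
    rw [uIcc_of_le htT.1.le] at hs
    exact (hP (t - s) (sub_nonneg.2 hs.2)).1 _ ξ
  refine ⟨fun t => P t c + ∫ s in (0 : ℝ)..t, P (t - s) (g s), ?_, hbound, hcoef⟩
  rw [intervalIntegrable_iff_integrableOn_Ioc_of_le hT]
  refine Integrable.mono' (g := fun t => rlKernel α t • ‖c‖ +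
    volterra (rlKernel α) (fun s => ‖g s‖) t) ?_ ?_ hbound
  · refine Integrable.add ?_ ?_
    · have := intervalIntegrable_rlKernel hα₀ 0 T
      rw [intervalIntegrable_iff_integrableOn_Ioc_of_le hT] at this
      exact Integrable.smul_const this _
    · have := (boundedConvolution_rlKernel_rlKernel one_pos hα₀ (by linarith)
        T).intervalIntegrable_volterra_right hg.norm hT
      rwa [intervalIntegrable_iff_integrableOn_Ioc_of_le hT] at this
  · refine e.aestronglyMeasurable_of_inner fun ξ => ?_
    have h1 := (boundedConvolution_rlKernel_mlKernel hα₀ hα₁ one_pos (by linarith) (hκ ξ)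
      T).intervalIntegrable_volterra_right (hgξ ξ) hT
    rw [intervalIntegrable_iff_integrableOn_Ioc_of_le hT] at h1
    have h2 : AEStronglyMeasurable (fun t => mlKernel α (κ ξ) t • ⟪e ξ, c⟫_𝕜)
        (volume.restrict (Ioc 0 T)) :=
      (measurable_mlKernel hα₀ (κ ξ)).aestronglyMeasurable.smul_const _
    exact (h2.add h1.1).congr (hcoef.mono fun t ht => (ht ξ).symm)

end Hilbert

/-! ### Uniqueness of the generalised solution. -/

section Operators

variable {𝕜 H I : Type*} [RCLike 𝕜] [NormedAddCommGroup H] [InnerProductSpace 𝕜 H]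
  [NormedSpace ℝ H] [CompleteSpace H]

/-- Pairing with `e ξ` is continuous, hence commutes with the fractional integral wherever that
integral converges, which is almost everywhere. -/
theorem IsGeneralisedSolution.inner_hasTimeDeriv {e : HilbertBasis I 𝕜 H} {L M : H →ₗ.[𝕜] H}
    {lam mu : I → ℝ} (hLM : JointlyDiagonal L M e lam mu) {α T : ℝ} (hα₁ : α < 1) (hT : 0 ≤ T)
    {φ : H} {f w : ℝ → H} (hw : IsGeneralisedSolution L M α T φ f w) (ξ : I) :
    ∃ d' : ℝ → 𝕜, HasTimeDeriv T (fun t => ((1 + lam ξ : ℝ) : 𝕜) * ⟪e ξ, w t⟫_𝕜) d' ∧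
      ∀ᵐ t ∂(volume.restrict (Icc 0 T)),
        fracIntegral (1 - α) d' t = ⟪e ξ, f t⟫_𝕜 - (mu ξ : 𝕜) * ⟪e ξ, w t⟫_𝕜 := by
  obtain ⟨Lw, Mw, v, hL, hM, ⟨g', hg', hv⟩, heq⟩ := hw.equation
  have h1α : 0 < 1 - α := sub_pos.2 hα₁
  have hc : ∀ t ∈ Icc 0 T,
      ⟪e ξ, w t + Lw t⟫_𝕜 = ((1 + lam ξ : ℝ) : 𝕜) * ⟪e ξ, w t⟫_𝕜 := fun t ht => by
    rw [inner_add_right, (hLM.diag_left _ _).1 (hL t ht) ξ]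
    push_cast
    ring
  have hd := hg'.clm_comp (innerSL 𝕜 (e ξ))
  refine ⟨fun t => ⟪e ξ, g' t⟫_𝕜, ⟨hd.1, fun t ht => ?_⟩, ?_⟩
  · simp only [← hc t ht, ← hc 0 ⟨le_rfl, hT⟩]
    exact hd.2 t ht
  · have hi := ae_intervalIntegrable_rlKernel h1α hT hg'.1
    rw [restrict_Ioc_eq_restrict_Icc] at hi
    filter_upwards [hv, hM, heq, hi] with t h1 h2 h3 h4
    rw [← (hLM.diag_right _ _).1 h2 ξ, ← inner_sub_right, ← h3, add_sub_cancel_right, h1,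
      fracIntegral_eq_volterra h1α.ne', fracIntegral_eq_volterra h1α.ne']
    exact (clm_volterra (innerSL 𝕜 (e ξ)) h4).symm

theorem IsGeneralisedSolution.eqOn {e : HilbertBasis I 𝕜 H} {L M : H →ₗ.[𝕜] H}
    {lam mu : I → ℝ} (hLM : JointlyDiagonal L M e lam mu) {α T : ℝ} (hα₀ : 0 < α) (hα₁ : α < 1)
    (hT : 0 ≤ T) {φ : H} {f w u : ℝ → H} (hw : IsGeneralisedSolution L M α T φ f w)
    (hu : IsGeneralisedSolution L M α T φ f u) : EqOn w u (Icc 0 T) := by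
  intro t ht
  refine e.ext_inner fun ξ => ?_
  obtain ⟨cL, hcL, hlam⟩ := hLM.left_pos
  have hlam1 : 0 < 1 + lam ξ := by linarith [hlam ξ]
  have h1α : 0 < 1 - α := sub_pos.2 hα₁
  obtain ⟨d₁, hd₁, hf₁⟩ := hw.inner_hasTimeDeriv hLM hα₁ hT ξ
  obtain ⟨d₂, hd₂, hf₂⟩ := hu.inner_hasTimeDeriv hLM hα₁ hT ξ
  have hi₁ := ae_intervalIntegrable_rlKernel h1α hT hd₁.1
  have hi₂ := ae_intervalIntegrable_rlKernel h1α hT hd₂.1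
  rw [restrict_Ioc_eq_restrict_Icc] at hi₁ hi₂
  have hz := (hd₁.sub hd₂).eq_zero_of_fracIntegral_eq (κ := mu ξ / (1 + lam ξ)) hα₀ hα₁
    (by simp [hw.initial, hu.initial]) (by
      filter_upwards [hf₁, hf₂, hi₁, hi₂] with s h1 h2 h3 h4
      have h5 : fracIntegral (1 - α) (fun t => d₁ t - d₂ t) s =
          fracIntegral (1 - α) d₁ s - fracIntegral (1 - α) d₂ s := by
        simp only [fracIntegral_eq_volterra h1α.ne', volterra, smul_sub]
        exact intervalIntegral.integral_sub h3 h4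
      have h6 : ((1 + lam ξ : ℝ) : 𝕜) ≠ 0 := by exact_mod_cast hlam1.ne'
      rw [h5, h1, h2, RCLike.real_smul_eq_coe_mul, RCLike.ofReal_div]
      field_simp
      ring) t ht
  have h6 : ((1 + lam ξ : ℝ) : 𝕜) ≠ 0 := by exact_mod_cast hlam1.ne'
  exact mul_left_cancel₀ h6 (sub_eq_zero.1 hz)

end Operators

/-! ### Existence. -/

theorem MemL2.clm_comp {𝕜 H F : Type*} [RCLike 𝕜] [NormedAddCommGroup H]
    [NormedSpace 𝕜 H] [NormedAddCommGroup F] [NormedSpace 𝕜 F] {T : ℝ}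
    (D : H →L[𝕜] F) {g : ℝ → H} (hg : MemL2 T g) : MemL2 T (fun t => D (g t)) :=
  D.comp_memLp' hg

theorem ContinuousOn.memL2 {E : Type*} [NormedAddCommGroup E] [NormedSpace ℝ E] {T : ℝ}
    {g : ℝ → E} (hg : ContinuousOn g (Icc 0 T)) : MemL2 T g := by
  obtain ⟨C, hC⟩ := isCompact_Icc.exists_bound_of_continuousOn hg
  refine MemLp.of_bound (hg.aestronglyMeasurable_of_isCompact isCompact_Icc measurableSet_Icc) C ?_
  filter_upwards [ae_restrict_mem measurableSet_Icc] with t ht using hC t ht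

section Existence

variable {𝕜 H I : Type*} [RCLike 𝕜] [NormedAddCommGroup H] [InnerProductSpace 𝕜 H]
  [NormedSpace ℝ H] [CompleteSpace H]

theorem continuous_mittagLeffler_rpow {α : ℝ} (hα : 0 < α) (κ : ℝ) :
    Continuous fun t : ℝ => mittagLeffler α 1 (-κ * t ^ α) :=
  (continuous_mittagLeffler hα one_pos).comp ((Real.continuous_rpow_const hα.le).const_mul _)

theorem mul_integral_mlKernel_response {α κ T t : ℝ} (hα₀ : 0 < α) (hα₁ : α < 1) (hκ : 0 ≤ κ)
    {c : 𝕜} {g g' q : ℝ → 𝕜} (hg : HasTimeDeriv T g g')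
    (hq : ∀ᵐ s ∂(volume.restrict (Ioc 0 T)),
      q s = mlKernel α κ s • c + volterra (mlKernel α κ) g' s)
    (ht : t ∈ Icc 0 T) :
    κ • ∫ s in (0 : ℝ)..t, q s = (1 - mittagLeffler α 1 (-κ * t ^ α)) • c + (g t - g 0)
      - volterra (fun s => mittagLeffler α 1 (-κ * s ^ α)) g' t := by
  rcases ht.1.eq_or_lt with rfl | ht₀
  · simp [volterra, Real.zero_rpow hα₀.ne', mittagLeffler_zero]
  have hg' : IntervalIntegrable g' volume 0 t := hg.1.mono_set (by
    rw [uIcc_of_le ht.1, uIcc_of_le (ht.1.trans ht.2)]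
    exact Icc_subset_Icc_right ht.2)
  have h := ((boundedConvolution_rlKernel_mlKernel hα₀ hα₁ one_pos (by linarith) hκ
    T).volterra_resolvent hg.1 hq ht₀ ht.2).2
  rw [← volterra_rlKernel_one, h, smul_add, smul_smul, mul_volterra_one_mlKernel hα₀ ht₀]
  have hY : IntervalIntegrable (fun s => mittagLeffler α 1 (-κ * (t - s) ^ α) • g' s) volume 0 t :=
    hg'.continuousOn_smul
      ((continuous_mittagLeffler_rpow hα₀ κ).comp (continuous_const.sub continuous_id)).continuousOn
  have h2 : κ • volterra (volterra (rlKernel 1) (mlKernel α κ)) g' t =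
      volterra (fun s => 1 - mittagLeffler α 1 (-κ * s ^ α)) g' t := by
    rw [volterra, ← intervalIntegral.integral_smul]
    simp_rw [smul_smul]
    exact volterra_congr (a := fun s => κ * volterra (rlKernel 1) (mlKernel α κ) s) ht.1
      (fun s hs _ => mul_volterra_one_mlKernel hα₀ hs) (Filter.Eventually.of_forall fun _ => rfl)
  have h3 : volterra (fun s => 1 - mittagLeffler α 1 (-κ * s ^ α)) g' t =
      (g t - g 0) - volterra (fun s => mittagLeffler α 1 (-κ * s ^ α)) g' t := by
    simp only [volterra, sub_smul, one_smul]
    rw [intervalIntegral.integral_sub hg' hY, hg.2 t ht, add_sub_cancel_left]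
  rw [h2, h3, add_sub_assoc]

/-- The derivative `q` of u + Lu is built first, and `u` recovered from it, so no series has to be
differentiated. -/
theorem exists_isGeneralisedSolution [Countable I] {e : HilbertBasis I 𝕜 H} {L M : H →ₗ.[𝕜] H}
    {lam mu : I → ℝ} (hLM : JointlyDiagonal L M e lam mu) {α T : ℝ} (hα₀ : 0 < α) (hα₁ : α < 1)
    (hT : 0 ≤ T) {φ : H} (hφL : φ ∈ L.domain) (hφM : φ ∈ M.domain) {f f' : ℝ → H}
    (hf : HasTimeDeriv T f f') :
    ∃ u : ℝ → H, IsGeneralisedSolution L M α T φ f u ∧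
      ∀ t ∈ Icc 0 T, ∀ ξ, (mu ξ : 𝕜) * ⟪e ξ, u t⟫_𝕜 =
        (mittagLeffler α 1 (-(mu ξ / (1 + lam ξ)) * t ^ α) : 𝕜) *
          ((mu ξ : 𝕜) * ⟪e ξ, φ⟫_𝕜 - ⟪e ξ, f 0⟫_𝕜) + ⟪e ξ, f t⟫_𝕜 -
        volterra (fun s => mittagLeffler α 1 (-(mu ξ / (1 + lam ξ)) * s ^ α))
          (fun s => ⟪e ξ, f' s⟫_𝕜) t := by
  obtain ⟨cL, hcL, hlam⟩ := hLM.left_pos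
  obtain ⟨cM, hcM, hmu⟩ := hLM.right_pos
  have h1α : 0 < 1 - α := sub_pos.2 hα₁
  have hlam0 : ∀ ξ, 0 < lam ξ := fun ξ => hcL.trans_le (hlam ξ)
  have hmu0 : ∀ ξ, 0 < mu ξ := fun ξ => hcM.trans_le (hmu ξ)
  have hlam1 : ∀ ξ, 0 < 1 + lam ξ := fun ξ => by linarith [hlam0 ξ]
  set κ : I → ℝ := fun ξ => mu ξ / (1 + lam ξ) with hκdef
  have hκ : ∀ ξ, 0 ≤ κ ξ := fun ξ => (div_pos (hmu0 ξ) (hlam1 ξ)).le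
  obtain ⟨Lφ, hLφ⟩ : ∃ y, (φ, y) ∈ L.graph := ⟨_, L.mem_graph ⟨φ, hφL⟩⟩
  obtain ⟨Mφ, hMφ⟩ : ∃ y, (φ, y) ∈ M.graph := ⟨_, M.mem_graph ⟨φ, hφM⟩⟩
  have hLφ' := (hLM.diag_left _ _).1 hLφ
  have hMφ' := (hLM.diag_right _ _).1 hMφ
  -- The value that the equation forces on the Caputo derivative of u + Lu as t → 0.
  set c : H := f 0 - Mφ with hc
  obtain ⟨q, hq, hqn, hqξ⟩ := e.exists_mlKernel_response hα₀ hα₁ hT hκ c hf.1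
  have hfξ : ∀ ξ, HasTimeDeriv T (fun t => ⟪e ξ, f t⟫_𝕜) (fun t => ⟪e ξ, f' t⟫_𝕜) :=
    fun ξ => hf.clm_comp (innerSL 𝕜 (e ξ))
  have hsub : ∀ t ∈ Icc 0 T, uIcc 0 t ⊆ uIcc 0 T := fun t ht => by
    rw [uIcc_of_le ht.1, uIcc_of_le hT]
    exact Icc_subset_Icc_right ht.2
  have hqt : ∀ t ∈ Icc 0 T, IntervalIntegrable q volume 0 t := fun t ht =>
    hq.mono_set (hsub t ht)
  -- `D` is (1+L)⁻¹, and `G` below is u + Lu.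
  obtain ⟨D, hD, -⟩ := e.exists_diagonal (m := fun ξ => (1 + lam ξ)⁻¹) zero_le_one fun ξ => by
    rw [abs_of_pos (inv_pos.2 (hlam1 ξ))]
    exact inv_le_one_of_one_le₀ (by linarith [hlam0 ξ])
  set G : ℝ → H := fun t => (φ + Lφ) + ∫ s in (0 : ℝ)..t, q s with hG
  have hGq : HasTimeDeriv T G q := ⟨hq, fun t ht => by simp [hG]⟩
  set v : ℝ → H := fun t => fracIntegral (1 - α) q t with hv
  -- the equation, in coordinates
  have hconv := boundedConvolution_rlKernel_rlKernel h1α hα₀ (by linarith) T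
  -- I^(1−α) turns the majorant of `q`, of order α, into one of order 1, which is bounded.
  have hvint : ∀ t, 0 < t → t ≤ T →
      IntervalIntegrable (fun s => rlKernel (1 - α) (t - s) • q s) volume 0 t ∧
      ‖v t‖ ≤ ‖c‖ + ∫ s in (0 : ℝ)..T, ‖f' s‖ := by
    intro t ht htT
    obtain ⟨h1, h2⟩ := hconv.volterra_resolvent (c := ‖c‖) hf.1.norm
      (Filter.Eventually.of_forall fun _ => rfl) ht htT
    have hqn' := ae_restrict_of_ae_restrict_of_subset (Ioc_subset_Ioc_right htT) hqn
    have h3 : IntervalIntegrable (fun s => rlKernel (1 - α) (t - s) • q s) volume 0 t := by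
      rw [intervalIntegrable_iff_integrableOn_Ioc_of_le ht.le] at h1 ⊢
      refine Integrable.mono' h1 ?_ ?_
      · refine AEStronglyMeasurable.smul ?_
          ((intervalIntegrable_iff_integrableOn_Ioc_of_le ht.le).1 (hqt t ⟨ht.le, htT⟩)).1
        exact ((measurable_rlKernel _).comp (measurable_const.sub measurable_id)).aestronglyMeasurable
      · filter_upwards [hqn', ae_restrict_mem measurableSet_Ioc] with s hs hst
        rw [norm_smul, Real.norm_of_nonneg (rlKernel_nonneg h1α (by linarith [hst.2])), smul_eq_mul]
        exact mul_le_mul_of_nonneg_left hs (rlKernel_nonneg h1α (by linarith [hst.2]))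
    refine ⟨h3, ?_⟩
    simp only [hv, fracIntegral_eq_volterra h1α.ne']
    refine (norm_volterra_le ht.le (fun _ => rlKernel_nonneg h1α) hqn' h1).trans ?_
    have hone : ∀ s, 0 < s → s ≤ t → volterra (rlKernel (1 - α)) (rlKernel α) s = rlKernel 1 s :=
      fun s hs _ => by rw [volterra_rlKernel_rlKernel h1α hα₀ hs, sub_add_cancel]
    rw [h2, hone t ht le_rfl, rlKernel_one, one_smul,
      volterra_congr ht.le hone (Filter.Eventually.of_forall fun _ => rfl), volterra_rlKernel_one]
    gcongr
    exact intervalIntegral.integral_mono_interval le_rfl ht.le htT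
      (Filter.Eventually.of_forall fun _ => norm_nonneg _) hf.1.norm
  have hvξ : ∀ t, 0 < t → t ≤ T → ∀ ξ, ⟪e ξ, v t⟫_𝕜 =
      mittagLeffler α 1 (-κ ξ * t ^ α) • ⟪e ξ, c⟫_𝕜 +
        volterra (fun s => mittagLeffler α 1 (-κ ξ * s ^ α)) (fun s => ⟪e ξ, f' s⟫_𝕜) t := by
    intro t ht htT ξ
    have h1 := ((boundedConvolution_rlKernel_mlKernel hα₀ hα₁ h1α (by linarith) (hκ ξ)
      T).volterra_resolvent (hfξ ξ).1 (hqξ.mono fun s hs => hs ξ) ht htT).2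
    have h2 := clm_volterra (innerSL 𝕜 (e ξ)) (hvint t ht htT).1
    simp only [innerSL_apply_apply] at h2
    simp only [hv, fracIntegral_eq_volterra h1α.ne']
    rw [h2, h1, volterra_one_sub_mlKernel hα₀ hα₁ ht]
    congr 1
    exact volterra_congr ht.le (fun s hs _ => volterra_one_sub_mlKernel hα₀ hα₁ hs)
      (Filter.Eventually.of_forall fun _ => rfl)
  have hGξ : ∀ t ∈ Icc 0 T, ∀ ξ, (κ ξ : 𝕜) * ⟪e ξ, ∫ s in (0 : ℝ)..t, q s⟫_𝕜 =
      (1 - mittagLeffler α 1 (-κ ξ * t ^ α)) • ⟪e ξ, c⟫_𝕜 + (⟪e ξ, f t⟫_𝕜 - ⟪e ξ, f 0⟫_𝕜)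
      - volterra (fun s => mittagLeffler α 1 (-κ ξ * s ^ α)) (fun s => ⟪e ξ, f' s⟫_𝕜) t := by
    intro t ht ξ
    have h1 := mul_integral_mlKernel_response hα₀ hα₁ (hκ ξ) (hfξ ξ)
      (hqξ.mono fun s hs => hs ξ) ht
    have h2 := intervalIntegral_clm_comp_comm (innerSL 𝕜 (e ξ)) (hqt t ht)
    simp only [innerSL_apply_apply] at h2
    rw [← h2, ← RCLike.real_smul_eq_coe_mul]
    exact h1
  have hne1 : ∀ ξ, (1 + (lam ξ : 𝕜)) ≠ 0 := fun ξ => by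
    exact_mod_cast (hlam1 ξ).ne'
  have hform : ∀ t ∈ Icc 0 T, ∀ ξ, (mu ξ : 𝕜) * ⟪e ξ, D (G t)⟫_𝕜 =
      (mittagLeffler α 1 (-κ ξ * t ^ α) : 𝕜) *
          ((mu ξ : 𝕜) * ⟪e ξ, φ⟫_𝕜 - ⟪e ξ, f 0⟫_𝕜) + ⟪e ξ, f t⟫_𝕜 -
        volterra (fun s => mittagLeffler α 1 (-κ ξ * s ^ α)) (fun s => ⟪e ξ, f' s⟫_𝕜) t := by
    intro t ht ξ
    have h1 : (mu ξ : 𝕜) * ⟪e ξ, D (G t)⟫_𝕜 = (mu ξ : 𝕜) * ⟪e ξ, φ⟫_𝕜 +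
        (κ ξ : 𝕜) * ⟪e ξ, ∫ s in (0 : ℝ)..t, q s⟫_𝕜 := by
      simp only [hD, hG, hκdef, inner_add_right, hLφ' ξ]
      push_cast
      have := hne1 ξ
      field_simp
    rw [h1, hGξ t ht ξ, RCLike.real_smul_eq_coe_mul, hc, inner_sub_right, hMφ' ξ]
    push_cast
    ring
  have hgraphL : ∀ t, (D (G t), G t - D (G t)) ∈ L.graph := fun t =>
    (hLM.diag_left _ _).2 fun ξ => by
      rw [inner_sub_right, hD]
      push_cast
      have := hne1 ξ
      field_simp
      ring
  -- Time 0 is excluded: there `v` is an integral over an empty interval, hence 0 instead of `c`.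
  have hgraphM : ∀ t, 0 < t → t ≤ T → (D (G t), f t - v t) ∈ M.graph := fun t ht htT =>
    (hLM.diag_right _ _).2 fun ξ => by
      rw [hform t ⟨ht.le, htT⟩ ξ, inner_sub_right, hvξ t ht htT, RCLike.real_smul_eq_coe_mul, hc,
        inner_sub_right, hMφ' ξ]
      ring
  -- regularity
  have hDG := hGq.clm_comp D
  have hfL2 : MemL2 T f := (hf.continuousOn hT).memL2
  have hDGL2 : MemL2 T fun t => D (G t) := (hDG.continuousOn hT).memL2
  have hpos : ∀ᵐ t ∂(volume.restrict (Icc 0 T)), 0 < t ∧ t ≤ T := by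
    rw [← restrict_Ioc_eq_restrict_Icc]
    exact ae_restrict_mem measurableSet_Ioc
  have hvL2 : MemL2 T v := by
    refine MemLp.of_bound ?_ _ (hpos.mono fun t ht => (hvint t ht.1 ht.2).2)
    refine e.aestronglyMeasurable_of_inner fun ξ => ?_
    -- The equation itself gives measurability of `v`: its coordinates are those of f − Mu.
    have h1 : AEStronglyMeasurable (fun t => ⟪e ξ, f t⟫_𝕜 - (mu ξ : 𝕜) * ⟪e ξ, D (G t)⟫_𝕜)
        (volume.restrict (Icc 0 T)) :=
      (hfL2.clm_comp (innerSL 𝕜 (e ξ))).1.sub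
        ((hDGL2.clm_comp (innerSL 𝕜 (e ξ))).1.const_mul _)
    refine h1.congr (hpos.mono fun t ht => ?_)
    simp only
    rw [← (hLM.diag_right _ _).1 (hgraphM t ht.1 ht.2) ξ, ← inner_sub_right, sub_sub_cancel]
  have hvD : HasCaputoDeriv α T (fun t => D (G t)) (fun t => D (v t)) := by
    refine ⟨_, hDG, hpos.mono fun t ht => ?_⟩
    simp only [hv, fracIntegral_eq_volterra h1α.ne']
    exact clm_volterra D (hvint t ht.1 ht.2).1
  have hvG : HasCaputoDeriv α T G v := ⟨q, hGq, Filter.Eventually.of_forall fun _ => rfl⟩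
  have hvL : HasCaputoDeriv α T (fun t => G t - D (G t)) (fun t => v t - D (v t)) := by
    refine ⟨_, hGq.sub hDG, hpos.mono fun t ht => ?_⟩
    have h1 := (hvint t ht.1 ht.2).1
    have h2 := clm_volterra (ContinuousLinearMap.id 𝕜 H - D) h1
    simp only [sub_apply, ContinuousLinearMap.id_apply] at h2
    simp only [hv, fracIntegral_eq_volterra h1α.ne']
    exact h2
  refine ⟨fun t => D (G t), ⟨⟨hDGL2, fun t => f t - v t, ?_, hfL2.sub hvL2⟩,
    ⟨⟨hDGL2, _, hvD, hvL2.clm_comp D⟩, fun t => G t - D (G t), fun t _ => hgraphL t,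
      ?_, _, hvL, hvL2.sub (hvL2.clm_comp D)⟩, ?_,
    fun t => G t - D (G t), fun t => f t - v t, v, fun t _ => hgraphL t, ?_, ?_, ?_⟩, hform⟩
  · exact hpos.mono fun t ht => hgraphM t ht.1 ht.2
  · exact MemLp.sub (hGq.continuousOn hT).memL2 hDGL2
  · refine e.ext_inner fun ξ => ?_
    simp only [hD, hG, intervalIntegral.integral_same, add_zero, inner_add_right, hLφ' ξ]
    push_cast
    have := hne1 ξ
    field_simp
  · exact hpos.mono fun t ht => hgraphM t ht.1 ht.2
  · simpa using hvG
  · exact Filter.Eventually.of_forall fun t => by simp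

end Existence

/-! ### The theorem and its series formula. -/

theorem theorem2p2 {𝕜 H I : Type*} [RCLike 𝕜] [NormedAddCommGroup H] [InnerProductSpace 𝕜 H]
    [NormedSpace ℝ H] [IsScalarTower ℝ 𝕜 H] [CompleteSpace H]
    [TopologicalSpace.SeparableSpace H] [Countable I]
    (e : HilbertBasis I 𝕜 H) (L M : H →ₗ.[𝕜] H) (lam mu : I → ℝ)
    (hLM : JointlyDiagonal L M e lam mu)
    (α T : ℝ) (hα₀ : 0 < α) (hα₁ : α < 1) (hT : 0 < T)
    (φ : H) (hφL : φ ∈ L.domain) (hφM : φ ∈ M.domain)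
    (f : ℝ → H) (hf : MemW 1 T f) :
    ∃ u : ℝ → H,
      IsGeneralisedSolution L M α T φ f u ∧
      (∀ w : ℝ → H, IsGeneralisedSolution L M α T φ f w → EqOn w u (Icc 0 T)) ∧
      ∀ f' : ℝ → H, HasTimeDeriv T f f' → ∀ t ∈ Icc 0 T,
        Summable (fun ξ =>
          (⟪e ξ, φ⟫_𝕜 * (mittagLeffler α 1 (-(mu ξ / (1 + lam ξ)) * t ^ α) : 𝕜)) • e ξ) ∧
        Summable (fun ξ => (⟪e ξ, f t⟫_𝕜 / (mu ξ : 𝕜)) • e ξ) ∧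
        Summable (fun ξ => (⟪e ξ, f 0⟫_𝕜 / (mu ξ : 𝕜) *
          (mittagLeffler α 1 (-(mu ξ / (1 + lam ξ)) * t ^ α) : 𝕜)) • e ξ) ∧
        Summable (fun ξ => (∫ s in (0 : ℝ)..t, ⟪e ξ, f' (t - s)⟫_𝕜 / (mu ξ : 𝕜) *
          (mittagLeffler α 1 (-(mu ξ / (1 + lam ξ)) * s ^ α) : 𝕜)) • e ξ) ∧
        u t =
          (∑' ξ, (⟪e ξ, φ⟫_𝕜 *
            (mittagLeffler α 1 (-(mu ξ / (1 + lam ξ)) * t ^ α) : 𝕜)) • e ξ)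
          + (∑' ξ, (⟪e ξ, f t⟫_𝕜 / (mu ξ : 𝕜)) • e ξ)
          - (∑' ξ, (⟪e ξ, f 0⟫_𝕜 / (mu ξ : 𝕜) *
            (mittagLeffler α 1 (-(mu ξ / (1 + lam ξ)) * t ^ α) : 𝕜)) • e ξ)
          - ∑' ξ, (∫ s in (0 : ℝ)..t, ⟪e ξ, f' (t - s)⟫_𝕜 / (mu ξ : 𝕜) *
            (mittagLeffler α 1 (-(mu ξ / (1 + lam ξ)) * s ^ α) : 𝕜)) • e ξ := by
  obtain ⟨cL, hcL, hlam⟩ := hLM.left_pos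
  obtain ⟨cM, hcM, hmu⟩ := hLM.right_pos
  have hmu0 : ∀ ξ, 0 < mu ξ := fun ξ => hcM.trans_le (hmu ξ)
  have hlam1 : ∀ ξ, 0 < 1 + lam ξ := fun ξ => by linarith [hlam ξ]
  obtain ⟨-, -, ⟨f₀', hf₀, -⟩, -⟩ := hf
  obtain ⟨u, hu, -⟩ := exists_isGeneralisedSolution hLM hα₀ hα₁ hT.le hφL hφM hf₀
  refine ⟨u, hu, fun w hw => hw.eqOn hLM hα₀ hα₁ hT.le hu, fun f' hf' t ht => ?_⟩
  -- A solution built from the given `f'` agrees with `u` by uniqueness, so the formula holds for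
  -- every choice of derivative of `f`.
  obtain ⟨u', hu', hform⟩ := exists_isGeneralisedSolution hLM hα₀ hα₁ hT.le hφL hφM hf'
  have hut : u t = u' t := hu.eqOn hLM hα₀ hα₁ hT.le hu' ht
  have hY : ∀ ξ, ‖(mittagLeffler α 1 (-(mu ξ / (1 + lam ξ)) * t ^ α) : 𝕜)‖ ≤ 1 := fun ξ => by
    have hx : 0 ≤ mu ξ / (1 + lam ξ) * t ^ α :=
      mul_nonneg (div_pos (hmu0 ξ) (hlam1 ξ)).le (Real.rpow_nonneg ht.1 _)
    rw [neg_mul, RCLike.norm_ofReal, abs_of_nonneg (mittagLeffler_neg_nonneg hα₀ hα₁ hα₁.le hx)]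
    simpa using mittagLeffler_neg_le hα₀ hα₁ one_pos hx
  have hdiv : ∀ (x : H) ξ, ‖⟪e ξ, x⟫_𝕜 / (mu ξ : 𝕜)‖ ≤ cM⁻¹ * ‖⟪e ξ, x⟫_𝕜‖ := fun x ξ => by
    rw [norm_div, RCLike.norm_ofReal, abs_of_pos (hmu0 ξ), div_eq_inv_mul]
    gcongr
    exact hmu ξ
  have hA := e.summable_smul (𝕜 := 𝕜) zero_le_one φ (c := fun ξ => ⟪e ξ, φ⟫_𝕜 *
      (mittagLeffler α 1 (-(mu ξ / (1 + lam ξ)) * t ^ α) : 𝕜)) fun ξ => by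
    rw [norm_mul, mul_comm]
    exact mul_le_mul_of_nonneg_right (hY ξ) (norm_nonneg _)
  have hB := e.summable_smul (𝕜 := 𝕜) (inv_pos.2 hcM).le (f t) (hdiv (f t))
  have hC := e.summable_smul (𝕜 := 𝕜) (inv_pos.2 hcM).le (f 0) (c := fun ξ =>
      ⟪e ξ, f 0⟫_𝕜 / (mu ξ : 𝕜) *
        (mittagLeffler α 1 (-(mu ξ / (1 + lam ξ)) * t ^ α) : 𝕜)) fun ξ => by
    rw [norm_mul]
    exact (mul_le_of_le_one_right (norm_nonneg _) (hY ξ)).trans (hdiv (f 0) ξ)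
  -- The fourth series needs no estimate: its coefficients combine those of the other three with the
  -- Fourier coefficients of `u t`, so its convergence and the formula come together.
  have hint : ∀ ξ, (∫ s in (0 : ℝ)..t, ⟪e ξ, f' (t - s)⟫_𝕜 / (mu ξ : 𝕜) *
      (mittagLeffler α 1 (-(mu ξ / (1 + lam ξ)) * s ^ α) : 𝕜)) =
      ⟪e ξ, φ⟫_𝕜 * (mittagLeffler α 1 (-(mu ξ / (1 + lam ξ)) * t ^ α) : 𝕜) +
        ⟪e ξ, f t⟫_𝕜 / (mu ξ : 𝕜) - ⟪e ξ, f 0⟫_𝕜 / (mu ξ : 𝕜) *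
        (mittagLeffler α 1 (-(mu ξ / (1 + lam ξ)) * t ^ α) : 𝕜) - ⟪e ξ, u t⟫_𝕜 := fun ξ => by
    have hne : (mu ξ : 𝕜) ≠ 0 := by exact_mod_cast (hmu0 ξ).ne'
    have h1 : (∫ s in (0 : ℝ)..t, ⟪e ξ, f' (t - s)⟫_𝕜 / (mu ξ : 𝕜) *
        (mittagLeffler α 1 (-(mu ξ / (1 + lam ξ)) * s ^ α) : 𝕜)) = (mu ξ : 𝕜)⁻¹ *
        volterra (fun s => mittagLeffler α 1 (-(mu ξ / (1 + lam ξ)) * s ^ α))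
          (fun s => ⟪e ξ, f' s⟫_𝕜) t := by
      rw [volterra, ← intervalIntegral.integral_const_mul]
      have h2 := intervalIntegral.integral_comp_sub_left (a := 0) (b := t)
        (fun s => (mu ξ : 𝕜)⁻¹ * (mittagLeffler α 1 (-(mu ξ / (1 + lam ξ)) * (t - s) ^ α) •
          ⟪e ξ, f' s⟫_𝕜)) t
      rw [sub_self, sub_zero] at h2
      rw [← h2]
      refine intervalIntegral.integral_congr fun s _ => ?_
      simp only [sub_sub_cancel, RCLike.real_smul_eq_coe_mul]
      ring
    have h3 := hform t ht ξ
    rw [← hut] at h3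
    rw [h1]
    generalize volterra (E := 𝕜) _ _ _ = V at h3 ⊢
    generalize mittagLeffler α 1 (-(mu ξ / (1 + lam ξ)) * t ^ α) = Y at h3 ⊢
    field_simp
    linear_combination h3
  have hsum := ((hA.hasSum.add hB.hasSum).sub hC.hasSum).sub (e.hasSum_inner_smul (u t))
  simp only [← add_smul, ← sub_smul, ← hint] at hsum
  refine ⟨hA, hB, hC, hsum.summable, ?_⟩
  rw [hsum.tsum_eq, sub_sub_cancel]
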